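/- Setting. Let $m\ge 1$ and $n_Q$ be integers and consider $n=n_Qm$ qubits, grouped into $n_Q$ consecutive blocks of $m$ qubits. For every input $\mathbf x$ let $U_{\rm enc}(\mathbf x)$ be an $n$-qubit unitary and $|\psi(\mathbf x)\rangle=U_{\rm enc}(\mathbf x)|0\rangle^{\otimes n}$. Let $\mathcal O$ be a traceless Hermitian operator on $m$ qubits and $O=\sum_{k=1}^{n_Q} I_{(k-1)m}\otimes\mathcal O\otimes I_{(n_Q-k)m}$, where $I_u$ is the identity on $u$ qubits. For $i=1,2,\dots$ let $U_i=U_i^1\otimes\cdots\otimes U_i^{n_Q}$, where the $U_i^k\in U(2^m)$ are independent random unitaries and the law of $U_i^k$ is a unitary 2-design (a probability measure on $U(2^m)$ whose moments of degree two in the entries and degree two in their complex conjugates are those of the Haar measure), depending only on $k$. The quantum features are $$f^Q(\mathbf x)_i=\langle\psi(\mathbf x)|U_i^\dagger O U_i|\psi(\mathbf x)\rangle .$$ Let $\sigma:\mathbb R\to\mathbb R$ be Lipschitz, $\xi\in\mathbb R$, and let the entries of the weights $W^{(\ell)}$ and of the biases $b^{(\ell)}$ be standard normal variables, independent of each other and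 of all $U_i^k$. For widths $n_0,\dots,n_{L-1}$ and $n_L=1$ the $L$-layer quantum-classical neural network (qcNN) is given by $$\alpha^{(0)}(\mathbf x)=\bigl(f^Q(\mathbf x)_i\bigr)_{i=1}^{n_0},\qquad \tilde\alpha^{(\ell+1)}(\mathbf x)=\frac1{\sqrt{n_\ell}}W^{(\ell)}\alpha^{(\ell)}(\mathbf x)+\xi b^{(\ell)}\ (0\le\ell<L),\qquad \alpha^{(\ell)}(\mathbf x)=\sigma(\tilde\alpha^{(\ell)}(\mathbf x))\ (1\le\ell<L),$$ and its scalar output at initialization is $f_{\theta(0)}(\mathbf x)=\tilde\alpha^{(L)}(\mathbf x)$. Let $\rho_{\mathbf x}^k$ be the reduced density matrix of $|\psi(\mathbf x)\rangle\langle\psi(\mathbf x)|$ on the $k$-th block, and define $$\Sigma_Q^{(1)}(\mathbf x,\mathbf x')=\frac{\mathrm{Tr}(\mathcal O^2)}{2^{2m}-1}\sum_{k=1}^{n_Q}\Bigl(\mathrm{Tr}(\rho_{\mathbf x}^k\rho_{\mathbf x'}^k)-\frac1{2^m}\Bigr)+\xi^2,$$ $$\Sigma_Q^{(\ell+1)}(\mathbf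 x,\mathbf x')=\mathbf E_{h\sim\mathcal N(0,\Sigma_Q^{(\ell)})}\bigl[\sigma(h(\mathbf x))\sigma(h(\mathbf x'))\bigr]+\xi^2\qquad(\ell\ge1),$$ where $h$ is a centered Gaussian process with covariance $\Sigma_Q^{(\ell)}$. Theorem. Let $L>1$. Every $\Sigma_Q^{(\ell)}$, $\ell\ge1$, is a covariance function (symmetric and positive semidefinite), the expectations above are well defined, and in the sequential infinite-width limit $n_0\to\infty$, then $n_1\to\infty$, …, then $n_{L-1}\to\infty$ the output $f_{\theta(0)}$ converges to a centered Gaussian process with covariance $\Sigma_Q^{(L)}$: for all inputs $\mathbf x^1,\dots,\mathbf x^N$ the law of $(f_{\theta(0)}(\mathbf x^1),\dots,f_{\theta(0)}(\mathbf x^N))$ satisfies, with respect to weak convergence and with all intermediate limits existing, $$\lim_{n_{L-1}\to\infty}\cdots\lim_{n_1\to\infty}\lim_{n_0\to\infty}\mathrm{Law}\bigl(f_{\theta(0)}(\mathbf x^1),\dots,f_{\theta(0)}(\mathbf x^N)\bigr)=\mathcal N\Bigl(0,\bigl(\Sigma_Q^{(L)}(\mathbf x^a,\mathbf x^c)\bigr)_{a,c=1}^N\Bigr).$$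 -/

import Mathlib

open MeasureTheory ProbabilityTheory Filter Topology Matrix
open scoped ComplexConjugate

noncomputable section

/-! ## Qubit registers and tensor products

`Block m` labels the computational basis of one block of `m` qubits (dimension `2 ^ m`);
`Register nQ m` labels the computational basis of `n = nQ * m` qubits, grouped into `nQ`
consecutive blocks of `m` qubits. -/

/-- Computational basis labels of `m` qubits. -/
abbrev Block (m : ℕ) : Type := Fin m → Fin 2

/-- Computational basis labels of `nQ` blocks of `m` qubits each. -/
abbrev Register (nQ m : ℕ) : Type := Fin nQ → Block m

/-- The unitary group `U(2 ^ m)` on a block. -/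
abbrev BlockUnitary (m : ℕ) : Type := Matrix.unitaryGroup (Block m) ℂ

/-- The tensor product `M 0 ⊗ M 1 ⊗ ⋯ ⊗ M (nQ - 1)` of block operators. -/
def tensorMat {nQ m : ℕ} (M : Fin nQ → Matrix (Block m) (Block m) ℂ) :
    Matrix (Register nQ m) (Register nQ m) ℂ :=
  Matrix.of fun s t => ∏ k, M k (s k) (t k)

/-- The observable `O = ∑ₖ I ⊗ ⋯ ⊗ I ⊗ 𝒪 ⊗ I ⊗ ⋯ ⊗ I`, with `𝒪` acting on the `k`-th block. -/
def localSum (nQ : ℕ) {m : ℕ} (𝒪 : Matrix (Block m) (Block m) ℂ) :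
    Matrix (Register nQ m) (Register nQ m) ℂ :=
  ∑ k : Fin nQ, tensorMat fun j => if j = k then 𝒪 else 1

/-- The state `|0⟩^{⊗ n}`. -/
def zeroState (nQ m : ℕ) : Register nQ m → ℂ := Pi.single 0 1

/-- The encoded state `|ψ(x)⟩ = U_enc(x) |0⟩^{⊗ n}`. -/
def encState {X : Type*} {nQ m : ℕ} (Uenc : X → Matrix.unitaryGroup (Register nQ m) ℂ) (x : X) :
    Register nQ m → ℂ :=
  (Uenc x : Matrix (Register nQ m) (Register nQ m) ℂ) *ᵥ zeroState nQ m

/-- The density matrix `|ψ⟩⟨ψ|` of a state vector. -/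
def pureDensity {nQ m : ℕ} (ψ : Register nQ m → ℂ) :
    Matrix (Register nQ m) (Register nQ m) ℂ :=
  Matrix.vecMulVec ψ (star ψ)

/-- Partial trace over all blocks except the `k`-th: the `(a, c)` entry sums
`⟨s| ρ |s'⟩` over all `s` with `s k = a`, where `s'` is `s` with its `k`-th block set to `c`. -/
def reduceTo {nQ m : ℕ} (k : Fin nQ) (ρ : Matrix (Register nQ m) (Register nQ m) ℂ) :
    Matrix (Block m) (Block m) ℂ :=
  Matrix.of fun a c =>
    ∑ s : Register nQ m, if s k = a then ρ s (Function.update s k c) else 0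

/-- The reduced density matrix `ρ_x^k`. -/
def reducedDensity {X : Type*} {nQ m : ℕ} (Uenc : X → Matrix.unitaryGroup (Register nQ m) ℂ)
    (k : Fin nQ) (x : X) : Matrix (Block m) (Block m) ℂ :=
  reduceTo k (pureDensity (encState Uenc x))

/-- The expectation value `⟨ψ(x)| V† O V |ψ(x)⟩` with `V = V¹ ⊗ ⋯ ⊗ V^{nQ}`; it is real when
`𝒪` is Hermitian. -/
def quantumFeature {X : Type*} {nQ m : ℕ} (Uenc : X → Matrix.unitaryGroup (Register nQ m) ℂ)
    (𝒪 : Matrix (Block m) (Block m) ℂ) (V : Fin nQ → BlockUnitary m) (x : X) : ℝ :=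
  (star (encState Uenc x) ⬝ᵥ
    (((tensorMat fun k => (V k : Matrix (Block m) (Block m) ℂ))ᴴ * localSum nQ 𝒪 *
      (tensorMat fun k => (V k : Matrix (Block m) (Block m) ℂ))) *ᵥ encState Uenc x)).re

/-! ## Unitary 2-designs -/

instance (m : ℕ) : MeasurableSpace (BlockUnitary m) := borel _

instance (m : ℕ) : BorelSpace (BlockUnitary m) := ⟨rfl⟩

instance (m : ℕ) : CompactSpace (BlockUnitary m) := by
  refine isCompact_iff_compactSpace.mp
    (?_ : IsCompact (Matrix.unitaryGroup (Block m) ℂ : Set (Matrix (Block m) (Block m) ℂ)))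
  have hK : IsCompact (Set.pi Set.univ fun _ : Block m =>
      Set.pi Set.univ fun _ : Block m => Metric.closedBall (0 : ℂ) 1) :=
    isCompact_univ_pi fun _ => isCompact_univ_pi fun _ => isCompact_closedBall _ _
  have hc : IsClosed {M : Matrix (Block m) (Block m) ℂ | M * star M = 1} :=
    isClosed_eq (continuous_id.mul continuous_star) continuous_const
  refine IsCompact.of_isClosed_subset (s := Set.pi Set.univ fun _ : Block m =>
      Set.pi Set.univ fun _ : Block m => Metric.closedBall (0 : ℂ) 1) hK ?_ ?_
  · have he : (Matrix.unitaryGroup (Block m) ℂ : Set (Matrix (Block m) (Block m) ℂ)) =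
        {M | M * star M = 1} := Set.ext fun M => Matrix.mem_unitaryGroup_iff
    rw [he]
    exact hc
  · intro M hM i _ j _
    simpa using entry_norm_bound_of_unitary (U := M) hM i j

/-- The normalized Haar measure on the unitary group of a block. -/
def haarUnitary (m : ℕ) : Measure (BlockUnitary m) := Measure.haarMeasure ⊤

/-- A probability measure on `U(2 ^ m)` is a unitary 2-design if it reproduces all Haar moments
that are of degree two in the entries of `U` and of degree two in their conjugates. -/
structure IsUnitaryTwoDesign {m : ℕ} (ν : Measure (BlockUnitary m)) : Prop where
  isProbabilityMeasure : IsProbabilityMeasure ν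
  moment_eq : ∀ a₁ c₁ a₂ c₂ a₃ c₃ a₄ c₄ : Block m,
    ∫ U : BlockUnitary m, U a₁ c₁ * U a₂ c₂ * conj (U a₃ c₃) * conj (U a₄ c₄) ∂ν =
      ∫ U : BlockUnitary m, U a₁ c₁ * U a₂ c₂ * conj (U a₃ c₃) * conj (U a₄ c₄) ∂(haarUnitary m)

/-! ## The covariance recursion -/

/-- The first-layer covariance
`Tr(𝒪²) / (2^{2m} - 1) * ∑ₖ (Tr(ρ_x^k ρ_{x'}^k) - 1 / 2^m) + ξ²`. -/
def covFirst {X : Type*} {nQ m : ℕ} (Uenc : X → Matrix.unitaryGroup (Register nQ m) ℂ)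
    (𝒪 : Matrix (Block m) (Block m) ℂ) (ξ : ℝ) (x x' : X) : ℝ :=
  (𝒪 * 𝒪).trace.re / ((2 : ℝ) ^ (2 * m) - 1) *
    ∑ k : Fin nQ, ((reducedDensity Uenc k x * reducedDensity Uenc k x').trace.re -
      1 / (2 : ℝ) ^ m) + ξ ^ 2

/-- The law of `(h(x), h(x'))` for a centered Gaussian process `h` with covariance `K`. -/
def gaussianPair {X : Type*} (K : X → X → ℝ) (x x' : X) : Measure (EuclideanSpace ℝ (Fin 2)) :=
  multivariateGaussian 0 !![K x x, K x x'; K x' x, K x' x']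

/-- The covariances `Σ^{(ℓ)}` for `ℓ ≥ 1`; the value at `ℓ = 0` is not used. -/
def covQ {X : Type*} {nQ m : ℕ} (Uenc : X → Matrix.unitaryGroup (Register nQ m) ℂ)
    (𝒪 : Matrix (Block m) (Block m) ℂ) (σ : ℝ → ℝ) (ξ : ℝ) : ℕ → X → X → ℝ
  | 0 => fun _ _ => 0
  | 1 => covFirst Uenc 𝒪 ξ
  | ℓ + 2 => fun x x' =>
      ∫ h, σ (h 0) * σ (h 1) ∂(gaussianPair (covQ Uenc 𝒪 σ ξ (ℓ + 1)) x x') + ξ ^ 2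

/-- The covariance matrix of a kernel on a finite family of inputs. -/
def gramMatrix {X : Type*} (K : X → X → ℝ) {N : ℕ} (x : Fin N → X) : Matrix (Fin N) (Fin N) ℝ :=
  Matrix.of fun a c => K (x a) (x c)

/-! ## The network -/

/-- The preactivations `α̃^{(ℓ)}(x)_j` for `ℓ ≥ 1`, as functions of the quantum features `q`, the
weights `W ℓ j k`, the biases `b ℓ j` and the widths `n ℓ`; the value at `ℓ = 0` is not used. -/
def preact (σ : ℝ → ℝ) (ξ : ℝ) (n : ℕ → ℕ) (W : ℕ → ℕ → ℕ → ℝ) (b : ℕ → ℕ → ℝ) (q : ℕ → ℝ) :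
    ℕ → ℕ → ℝ
  | 0 => fun _ => 0
  | 1 => fun j => 1 / √(n 0 : ℝ) * ∑ i ∈ Finset.range (n 0), W 0 j i * q i + ξ * b 0 j
  | ℓ + 2 => fun j =>
      1 / √(n (ℓ + 1) : ℝ) *
        ∑ k ∈ Finset.range (n (ℓ + 1)), W (ℓ + 1) j k * σ (preact σ ξ n W b q (ℓ + 1) k) +
      ξ * b (ℓ + 1) j

/-- The random initialization: the `U i k` have law `ν k`, all weights and biases are standard
normal, and all these random variables are mutually independent. -/
structure IsInitialization {nQ m : ℕ} (ν : Fin nQ → Measure (BlockUnitary m))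
    {Ω : Type*} [MeasurableSpace Ω] (P : Measure Ω) (U : ℕ → Fin nQ → Ω → BlockUnitary m)
    (W : ℕ → ℕ → ℕ → Ω → ℝ) (b : ℕ → ℕ → Ω → ℝ) : Prop where
  measurable_U : ∀ i k, Measurable (U i k)
  measurable_W : ∀ ℓ j k, Measurable (W ℓ j k)
  measurable_b : ∀ ℓ j, Measurable (b ℓ j)
  law_U : ∀ i k, HasLaw (U i k) (ν k) P
  law_W : ∀ ℓ j k, HasLaw (W ℓ j k) (gaussianReal 0 1) P
  law_b : ∀ ℓ j, HasLaw (b ℓ j) (gaussianReal 0 1) P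
  indep_U : iIndepFun (fun (p : ℕ × Fin nQ) => U p.1 p.2) P
  indep_Wb : iIndepFun (Sum.elim (fun p : ℕ × ℕ × ℕ => W p.1 p.2.1 p.2.2)
    (fun p : ℕ × ℕ => b p.1 p.2)) P
  indep_U_Wb : IndepFun (fun ω (p : ℕ × Fin nQ) => U p.1 p.2 ω)
    (fun ω (p : ℕ × ℕ × ℕ ⊕ ℕ × ℕ) =>
      Sum.elim (fun p : ℕ × ℕ × ℕ => W p.1 p.2.1 p.2.2) (fun p : ℕ × ℕ => b p.1 p.2) p ω) P

/-- The scalar output of the `L`-layer network of widths `n 0, …, n (L - 1)`, with a linear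
output node, at the input `x`. -/
def qcnnOutput {X Ω : Type*} {nQ m : ℕ} (Uenc : X → Matrix.unitaryGroup (Register nQ m) ℂ)
    (𝒪 : Matrix (Block m) (Block m) ℂ) (σ : ℝ → ℝ) (ξ : ℝ) (L : ℕ)
    (U : ℕ → Fin nQ → Ω → BlockUnitary m) (W : ℕ → ℕ → ℕ → Ω → ℝ) (b : ℕ → ℕ → Ω → ℝ)
    (n : ℕ → ℕ) (x : X) (ω : Ω) : ℝ :=
  preact σ ξ n (fun ℓ j k => W ℓ j k ω) (fun ℓ j => b ℓ j ω)
    (fun i => quantumFeature Uenc 𝒪 (fun k => U i k ω) x) L 0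

lemma continuous_quantumFeature {X : Type*} {nQ m : ℕ}
    (Uenc : X → Matrix.unitaryGroup (Register nQ m) ℂ) (𝒪 : Matrix (Block m) (Block m) ℂ)
    (x : X) : Continuous fun V : Fin nQ → Matrix (Block m) (Block m) ℂ =>
      (star (encState Uenc x) ⬝ᵥ
        (((tensorMat V)ᴴ * localSum nQ 𝒪 * (tensorMat V)) *ᵥ encState Uenc x)).re := by
  have h : Continuous fun V : Fin nQ → Matrix (Block m) (Block m) ℂ => tensorMat V := by
    refine continuous_matrix fun s t => ?_
    exact continuous_finsetProd Finset.univ fun k _ =>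
      Continuous.matrix_elem (A := fun V : Fin nQ → Matrix (Block m) (Block m) ℂ => V k)
        (continuous_apply k) (s k) (t k)
  fun_prop

lemma measurable_quantumFeature {X Ω : Type*} [MeasurableSpace Ω] {nQ m : ℕ}
    (Uenc : X → Matrix.unitaryGroup (Register nQ m) ℂ) (𝒪 : Matrix (Block m) (Block m) ℂ)
    (x : X) {V : Fin nQ → Ω → BlockUnitary m} (hV : ∀ k, Measurable (V k)) :
    Measurable fun ω => quantumFeature Uenc 𝒪 (fun k => V k ω) x := by
  have h : Measurable fun ω (k : Fin nQ) (a c : Block m) =>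
      (V k ω : Matrix (Block m) (Block m) ℂ) a c := by
    refine measurable_pi_lambda _ fun k => measurable_pi_lambda _ fun a =>
      measurable_pi_lambda _ fun c => ?_
    have hc : Continuous fun u : BlockUnitary m => (u : Matrix (Block m) (Block m) ℂ) a c :=
      continuous_subtype_val.matrix_elem a c
    exact hc.measurable.comp (hV k)
  have hc : Continuous fun V : Fin nQ → Block m → Block m → ℂ =>
      (star (encState Uenc x) ⬝ᵥ
        (((tensorMat (fun k => Matrix.of (V k)))ᴴ * localSum nQ 𝒪 *
          (tensorMat (fun k => Matrix.of (V k)))) *ᵥ encState Uenc x)).re :=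
    continuous_quantumFeature Uenc 𝒪 x
  exact hc.measurable.comp h

lemma measurable_preact {Ω : Type*} [MeasurableSpace Ω] {σ : ℝ → ℝ} (hσ : Measurable σ) (ξ : ℝ)
    (n : ℕ → ℕ) {W : ℕ → ℕ → ℕ → Ω → ℝ} {b : ℕ → ℕ → Ω → ℝ} {q : ℕ → Ω → ℝ}
    (hW : ∀ ℓ j k, Measurable (W ℓ j k)) (hb : ∀ ℓ j, Measurable (b ℓ j))
    (hq : ∀ i, Measurable (q i)) (ℓ : ℕ) : ∀ j,
    Measurable fun ω => preact σ ξ n (fun ℓ j k => W ℓ j k ω) (fun ℓ j => b ℓ j ω)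
      (fun i => q i ω) ℓ j := by
  induction ℓ with
  | zero => intro j; simpa only [preact] using measurable_const
  | succ ℓ ih =>
    intro j
    cases ℓ with
    | zero =>
      simp only [preact]
      exact ((Finset.measurable_fun_sum _ fun i _ => (hW 0 j i).mul (hq i)).const_mul _).add
        ((hb 0 j).const_mul _)
    | succ ℓ =>
      simp only [preact]
      exact ((Finset.measurable_fun_sum _ fun k _ =>
        (hW (ℓ + 1) j k).mul (hσ.comp (ih k))).const_mul _).add ((hb (ℓ + 1) j).const_mul _)

lemma IsInitialization.measurable_output {X Ω : Type*} [MeasurableSpace Ω] {nQ m : ℕ}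
    {ν : Fin nQ → Measure (BlockUnitary m)} {P : Measure Ω}
    {U : ℕ → Fin nQ → Ω → BlockUnitary m} {W : ℕ → ℕ → ℕ → Ω → ℝ} {b : ℕ → ℕ → Ω → ℝ}
    (hI : IsInitialization ν P U W b) (Uenc : X → Matrix.unitaryGroup (Register nQ m) ℂ)
    (𝒪 : Matrix (Block m) (Block m) ℂ) {σ : ℝ → ℝ} (hσ : Measurable σ) (ξ : ℝ) (L : ℕ)
    (n : ℕ → ℕ) (x : X) : Measurable (qcnnOutput Uenc 𝒪 σ ξ L U W b n x) :=
  measurable_preact hσ ξ n hI.measurable_W hI.measurable_b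
    (fun i => measurable_quantumFeature Uenc 𝒪 x (hI.measurable_U i)) L 0

/-- The joint law of the outputs at the inputs `x 0, …, x (N - 1)`. -/
def outputLaw {X Ω : Type*} [MeasurableSpace Ω] {nQ m : ℕ}
    {ν : Fin nQ → Measure (BlockUnitary m)} {P : Measure Ω} [IsProbabilityMeasure P]
    {U : ℕ → Fin nQ → Ω → BlockUnitary m} {W : ℕ → ℕ → ℕ → Ω → ℝ} {b : ℕ → ℕ → Ω → ℝ}
    (hI : IsInitialization ν P U W b) (Uenc : X → Matrix.unitaryGroup (Register nQ m) ℂ)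
    (𝒪 : Matrix (Block m) (Block m) ℂ) {σ : ℝ → ℝ} (hσ : Measurable σ) (ξ : ℝ) (L : ℕ)
    {N : ℕ} (x : Fin N → X) (n : ℕ → ℕ) : ProbabilityMeasure (EuclideanSpace ℝ (Fin N)) :=
  ⟨P.map fun ω => WithLp.toLp 2 fun a => qcnnOutput Uenc 𝒪 σ ξ L U W b n (x a) ω,
    Measure.isProbabilityMeasure_map ((WithLp.measurable_toLp 2 (Fin N → ℝ)).comp
      (measurable_pi_lambda _ fun a =>
        hI.measurable_output Uenc 𝒪 hσ ξ L n (x a))).aemeasurable⟩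

/-- The centered Gaussian measure with covariance matrix `S`. -/
def centeredGaussian {N : ℕ} (S : Matrix (Fin N) (Fin N) ℝ) :
    ProbabilityMeasure (EuclideanSpace ℝ (Fin N)) :=
  ⟨multivariateGaussian 0 S, inferInstance⟩

/-! ## Sequential limits -/

/-- `lim_{n_{L-1} → ∞} ⋯ lim_{n_1 → ∞} lim_{n_0 → ∞} F n = a`, all intermediate limits existing:
`G ℓ` is the limit after `n_0, …, n_{ℓ-1}` have been sent to infinity, one after the other. -/
def SequentialLimit {E : Type*} [TopologicalSpace E] (L : ℕ) (F : (ℕ → ℕ) → E) (a : E) : Prop :=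
  ∃ G : ℕ → (ℕ → ℕ) → E, G 0 = F ∧
    (∀ ℓ < L, ∀ n : ℕ → ℕ,
      Tendsto (fun w : ℕ => G ℓ (Function.update n ℓ w)) atTop (𝓝 (G (ℓ + 1) n))) ∧
    ∀ n, G L n = a

end

/-! Given the activations of one layer, the neurons of the next are independent centered Gaussian
vectors, indexed by the `N` inputs, whose common covariance is the empirical covariance `empCov` of
those activations (`map_affineRow`). A layer therefore influences its successors in law only through
one `N × N` matrix. The weights can be traded for independent standard Gaussian vectors, each
multiplied by the square root of that matrix; this leaves the output law unchanged for every choice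
of widths (`map_chain_congr`, `IsInitialization.outputLaw_eq_map_gaussStep`).

In this realization, with the noise and the later widths frozen, the output is a continuous function
of the covariance matrix on the positive semidefinite cone (`continuousOn_gaussOut`). When a width
tends to infinity, the strong law sends the empirical covariance almost surely to a deterministic
matrix, so the outputs converge almost surely along the coupling, hence in law
(`tendsto_law_gaussOut`). Each limit leaves a network of the same kind with one random layer fewer,
now started from a deterministic covariance, and the next width can be treated in the same way.
After the last limit only a Gaussian vector remains.

The matrices in the limit obey the recursion: at the hidden layers the strong law averages `σ(h a)
σ(h c)` over Gaussian vectors `h` (`tendsto_gaussOutLaw`), at the input it averages products of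
quantum features (`IsInitialization.integral_features_mul`). The latter needs the second moments of
`Vᴴ 𝒪 V`. A 2-design has the Haar values; unitary invariance reduces a Hermitian matrix to a
diagonal one, and permutation invariance leaves `β Tr(M²) + r (Tr M)²`. Two test inputs, the
identity and a sum over Hermitian matrices that yields the swap operator, fix the constants. For
traceless `𝒪` the first moments vanish, so distinct blocks are uncorrelated, and each block
contributes through its reduced density matrices. -/

noncomputable section

/-! ## Gaussian vectors with prescribed covariance -/

section CovRoot

open scoped MatrixOrder

/-- The linear map `√S`, which sends a standard Gaussian vector to one with covariance `S`. -/
def covRoot {N : ℕ} (S : Matrix (Fin N) (Fin N) ℝ) (z : EuclideanSpace ℝ (Fin N)) :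
    EuclideanSpace ℝ (Fin N) :=
  toEuclideanCLM (𝕜 := ℝ) (CFC.sqrt S) z

lemma map_covRoot_stdGaussian {N : ℕ} (S : Matrix (Fin N) (Fin N) ℝ) :
    (stdGaussian (EuclideanSpace ℝ (Fin N))).map (covRoot S) = multivariateGaussian 0 S := by
  simp only [multivariateGaussian, zero_add]
  rfl

lemma continuous_covRoot {N : ℕ} (S : Matrix (Fin N) (Fin N) ℝ) : Continuous (covRoot S) :=
  (toEuclideanCLM (𝕜 := ℝ) (CFC.sqrt S)).continuous

lemma covRoot_apply {N : ℕ} (S : Matrix (Fin N) (Fin N) ℝ) (z : EuclideanSpace ℝ (Fin N)) :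
    covRoot S z = WithLp.toLp 2 (CFC.sqrt S *ᵥ WithLp.ofLp z) := rfl

attribute [irreducible] covRoot

open scoped Matrix.Norms.L2Operator in
lemma continuousOn_matrixSqrt (N : ℕ) :
    ContinuousOn (CFC.sqrt : Matrix (Fin N) (Fin N) ℝ → Matrix (Fin N) (Fin N) ℝ)
      {S | S.PosSemidef} := by
  have h := CFC.continuousOn_sqrt (A := Matrix (Fin N) (Fin N) ℝ)
  have he : {S : Matrix (Fin N) (Fin N) ℝ | S.PosSemidef} = {S | 0 ≤ S} := by
    ext S; simp [Matrix.nonneg_iff_posSemidef]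
  rw [he]
  exact h

lemma continuousOn_covRoot {N : ℕ} :
    ContinuousOn (fun p : Matrix (Fin N) (Fin N) ℝ × EuclideanSpace ℝ (Fin N) => covRoot p.1 p.2)
      {p | p.1.PosSemidef} := by
  simp only [covRoot_apply]
  refine (PiLp.continuous_toLp 2 _).comp_continuousOn ?_
  have h1 : ContinuousOn (fun p : Matrix (Fin N) (Fin N) ℝ × EuclideanSpace ℝ (Fin N) =>
      CFC.sqrt p.1) {p | p.1.PosSemidef} :=
    (continuousOn_matrixSqrt N).comp continuousOn_fst fun p hp => hp
  have h2 : Continuous fun q : Matrix (Fin N) (Fin N) ℝ × (Fin N → ℝ) => q.1 *ᵥ q.2 := by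
    fun_prop
  exact h2.comp_continuousOn (h1.prodMk (by fun_prop))

/-- Cut out by one closed equation and one closed inequality per vector. Closedness of the cone is
what makes the piecewise description of `covRoot` measurable. -/
lemma isClosed_posSemidef (N : ℕ) : IsClosed {S : Matrix (Fin N) (Fin N) ℝ | S.PosSemidef} := by
  have : {S : Matrix (Fin N) (Fin N) ℝ | S.PosSemidef} =
      {S | Sᴴ = S} ∩ ⋂ x : Fin N → ℝ, {S | 0 ≤ star x ⬝ᵥ (S *ᵥ x)} := by
    ext S
    simp only [Set.mem_ofPred_eq, Set.mem_inter_iff, Set.mem_iInter]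
    exact posSemidef_iff_dotProduct_mulVec
  rw [this]
  refine (isClosed_eq (by fun_prop) continuous_id).inter (isClosed_iInter fun x => ?_)
  exact isClosed_le continuous_const (by fun_prop)

lemma covRoot_of_not_posSemidef {N : ℕ} {S : Matrix (Fin N) (Fin N) ℝ}
    (hS : ¬ S.PosSemidef) : covRoot S = 0 := by
  ext1 z
  have : CFC.sqrt S = 0 := by
    rw [CFC.sqrt, cfcₙ_apply_of_not_predicate]
    -- Outside its domain `0 ≤ S` the functional calculus returns 0, and `0 ≤ S` unfolds to `S - 0`
    -- being positive semidefinite.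
    change ¬ (S - 0).PosSemidef
    simpa
  rw [covRoot_apply, this]
  simp

end CovRoot

/-- The entries of a matrix, as a measurable structure. -/
instance {N : ℕ} : MeasurableSpace (Matrix (Fin N) (Fin N) ℝ) := MeasurableSpace.pi

instance {N : ℕ} : BorelSpace (Matrix (Fin N) (Fin N) ℝ) :=
  inferInstanceAs (BorelSpace (Fin N → Fin N → ℝ))

/-- Jointly continuous on the closed positive semidefinite cone and 0 off it, hence a piecewise
function with measurable pieces. -/
lemma measurable_covRoot {N : ℕ} :
    Measurable fun p : Matrix (Fin N) (Fin N) ℝ × EuclideanSpace ℝ (Fin N) =>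
      covRoot p.1 p.2 := by
  classical
  have hc : IsClosed {p : Matrix (Fin N) (Fin N) ℝ × EuclideanSpace ℝ (Fin N) |
      p.1.PosSemidef} := (isClosed_posSemidef N).preimage continuous_fst
  have h := continuousOn_covRoot.measurable_piecewise (g := fun _ => (0 : EuclideanSpace ℝ (Fin N)))
    continuousOn_const hc.measurableSet
  convert h using 1
  ext1 p
  by_cases hp : p.1.PosSemidef
  · simp [Set.piecewise, hp]
  · simp [Set.piecewise, hp, covRoot_of_not_posSemidef hp]

lemma Measurable.covRoot {Ω : Type*} [MeasurableSpace Ω] {N : ℕ}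
    {S : Ω → Matrix (Fin N) (Fin N) ℝ} {z : Ω → EuclideanSpace ℝ (Fin N)} (hS : Measurable S)
    (hz : Measurable z) : Measurable fun ω => covRoot (S ω) (z ω) := by
  have h := measurable_covRoot.comp (hS.prodMk hz)
  exact h

/-! ## One layer conditionally on the previous one -/

/-- The covariance of a Gaussian affine layer with inputs `v 0, …, v (n - 1)`. -/
def empCov {N : ℕ} (ξ : ℝ) (n : ℕ) (v : ℕ → Fin N → ℝ) : Matrix (Fin N) (Fin N) ℝ :=
  Matrix.of fun a c => (n : ℝ)⁻¹ * ∑ k ∈ Finset.range n, v k a * v k c + ξ ^ 2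

/-- One neuron with weights `r (some k)` and bias `r none`, at `N` inputs. -/
def affineRow {N : ℕ} (ξ : ℝ) (n : ℕ) (v : ℕ → Fin N → ℝ) (r : Option ℕ → ℝ) (a : Fin N) : ℝ :=
  1 / √(n : ℝ) * ∑ k ∈ Finset.range n, r (some k) * v k a + ξ * r none

lemma continuous_empCov {N : ℕ} (ξ : ℝ) (n : ℕ) :
    Continuous fun v : ℕ → Fin N → ℝ => empCov ξ n v := by
  refine continuous_matrix fun a c => ?_
  simp only [empCov, Matrix.of_apply]
  fun_prop

/-- This sum of squares serves twice: for positivity of `empCov`, and as the exponent of the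
characteristic function in `map_affineRow`. -/
lemma dotProduct_empCov {N : ℕ} (ξ : ℝ) (n : ℕ) (v : ℕ → Fin N → ℝ) (t : Fin N → ℝ) :
    t ⬝ᵥ empCov ξ n v *ᵥ t =
      (n : ℝ)⁻¹ * ∑ k ∈ Finset.range n, (∑ a, t a * v k a) ^ 2 + (ξ * ∑ a, t a) ^ 2 := by
  simp only [dotProduct, mulVec, empCov, Matrix.of_apply]
  have h : ∀ k, (∑ a, t a * v k a) ^ 2 = ∑ a, ∑ c, t a * ((v k a * v k c) * t c) := fun k => by
    rw [sq, Finset.sum_mul_sum]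
    exact Finset.sum_congr rfl fun a _ => Finset.sum_congr rfl fun c _ => by ring
  have h' : (ξ * ∑ a, t a) ^ 2 = ∑ a, ∑ c, t a * (ξ ^ 2 * t c) := by
    rw [mul_pow, sq (∑ a, t a), Finset.sum_mul_sum, Finset.mul_sum]
    refine Finset.sum_congr rfl fun a _ => ?_
    rw [Finset.mul_sum]
    exact Finset.sum_congr rfl fun c _ => by ring
  rw [h']
  simp only [h, add_mul, Finset.sum_add_distrib, mul_add, Finset.mul_sum, Finset.sum_mul]
  congr 1
  rw [Finset.sum_comm (s := Finset.range n)]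
  refine Finset.sum_congr rfl fun a _ => ?_
  rw [Finset.sum_comm (s := Finset.range n)]
  refine Finset.sum_congr rfl fun c _ => Finset.sum_congr rfl fun k _ => by ring

lemma posSemidef_empCov {N : ℕ} (ξ : ℝ) (n : ℕ) (v : ℕ → Fin N → ℝ) :
    (empCov ξ n v).PosSemidef := by
  rw [posSemidef_iff_dotProduct_mulVec]
  refine ⟨?_, fun t => ?_⟩
  · ext a c
    simp [empCov, mul_comm]
  · rw [star_trivial, dotProduct_empCov]
    positivity

lemma measurable_affineRow {N : ℕ} (ξ : ℝ) (n : ℕ) :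
    Measurable fun p : (ℕ → Fin N → ℝ) × (Option ℕ → ℝ) => affineRow ξ n p.1 p.2 := by
  unfold affineRow
  fun_prop

/-- Paired with a fixed `t`, a neuron is a finite linear combination of independent standard
normals; its variance is the quadratic form of `empCov` at `t`, so the characteristic functions
agree. -/
lemma map_affineRow {N : ℕ} (ξ : ℝ) (n : ℕ) (v : ℕ → Fin N → ℝ) :
    (Measure.infinitePi fun _ : Option ℕ => gaussianReal 0 1).map
      (fun r => WithLp.toLp 2 (affineRow ξ n v r)) = multivariateGaussian 0 (empCov ξ n v) := by
  have hm : Measurable fun r : Option ℕ → ℝ => WithLp.toLp 2 (affineRow ξ n v r) :=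
    (WithLp.measurable_toLp 2 (Fin N → ℝ)).comp
      ((measurable_affineRow ξ n).comp (measurable_const.prodMk measurable_id))
  have := Measure.isProbabilityMeasure_map
    (μ := Measure.infinitePi fun _ : Option ℕ => gaussianReal 0 1) hm.aemeasurable
  refine Measure.ext_of_charFun ?_
  ext t
  -- The coefficients of the linear form `r ↦ ⟨affineRow ξ n v r, t⟩`.
  obtain ⟨c, hc0, hc1⟩ : ∃ c : Option ℕ → ℝ, c none = ξ * ∑ a, t a ∧
      ∀ k, c (some k) = 1 / √(n : ℝ) * ∑ a, t a * v k a :=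
    ⟨fun o => o.elim (ξ * ∑ a, t a) fun k => 1 / √(n : ℝ) * ∑ a, t a * v k a, rfl, fun _ => rfl⟩
  set s : Finset (Option ℕ) := Finset.insertNone (Finset.range n) with hs
  have hin : ∀ r : Option ℕ → ℝ, inner ℝ (WithLp.toLp 2 (affineRow ξ n v r)) t =
      ∑ o ∈ s, c o * r o := fun r => by
    rw [hs, Finset.sum_insertNone, PiLp.inner_apply]
    simp only [hc0, hc1, affineRow, RCLike.inner_apply, conj_trivial, mul_add,
      Finset.sum_add_distrib, Finset.mul_sum, Finset.sum_mul]
    rw [add_comm, Finset.sum_comm]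
    congr 1
    · exact Finset.sum_congr rfl fun a _ => by ring
    · refine Finset.sum_congr rfl fun k _ => Finset.sum_congr rfl fun a _ => by ring
  have hind : iIndepFun (fun (o : s) (r : Option ℕ → ℝ) => c o * r o)
      (Measure.infinitePi fun _ : Option ℕ => gaussianReal 0 1) :=
    (iIndepFun_infinitePi (P := fun _ : Option ℕ => gaussianReal 0 1)
      (X := fun o (y : ℝ) => c o * y) (fun o => by fun_prop)).precomp Subtype.val_injective
  have hmc : ∀ o, Measurable fun r : Option ℕ → ℝ => c o * r o := fun o =>
    (measurable_pi_apply o).const_mul _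
  have hlaw : ∀ o, (Measure.infinitePi fun _ : Option ℕ => gaussianReal 0 1).map
      (fun r => c o * r o) = gaussianReal 0 (NNReal.mk (c o ^ 2) (sq_nonneg _)) := fun o => by
    have h1 : (fun r : Option ℕ → ℝ => c o * r o) = (fun y => c o * y) ∘ fun r => r o := rfl
    rw [h1, ← Measure.map_map (by fun_prop) (by fun_prop), Measure.infinitePi_map_eval,
      gaussianReal_map_const_mul]
    simp
  -- The value at 1 for the scalar pairing is the value at `t` for the vector.
  have hsum : charFun ((Measure.infinitePi fun _ : Option ℕ => gaussianReal 0 1).map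
      (fun r => ∑ o ∈ s, c o * r o)) 1 =
      Complex.exp (-(∑ o ∈ s, (c o : ℂ) ^ 2) / 2) := by
    rw [iIndepFun.charFun_map_fun_finsetSum_eq_prod (X := fun o (r : Option ℕ → ℝ) => c o * r o)
      (fun i _ => (hmc i).aemeasurable) hind, Finset.prod_apply]
    simp only [hlaw, charFun_gaussianReal]
    rw [← Complex.exp_sum]
    congr 1
    rw [neg_div, Finset.sum_div, ← Finset.sum_neg_distrib]
    refine Finset.sum_congr rfl fun o _ => ?_
    simp
  rw [charFun_multivariateGaussian (posSemidef_empCov ξ n v), charFun_apply,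
    integral_map hm.aemeasurable (by fun_prop)]
  rw [charFun_apply_real, integral_map (Finset.measurable_fun_sum s fun o _ => hmc o).aemeasurable
    (by fun_prop)] at hsum
  simp only [hin]
  simp only [Complex.ofReal_one, one_mul] at hsum
  rw [hsum, inner_zero_right, dotProduct_empCov]
  congr 1
  rw [hs, Finset.sum_insertNone]
  simp only [hc0, hc1]
  -- Also true for `n = 0`, where both factors take the default value 0.
  have hn : ∀ x : ℝ, (1 / √(n : ℝ) * x) ^ 2 = (n : ℝ)⁻¹ * x ^ 2 := fun x => by
    rw [mul_pow, div_pow, Real.sq_sqrt (by positivity)]; simp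
  simp only [← Complex.ofReal_pow, hn]
  rw [← Complex.ofReal_sum, ← Finset.mul_sum]
  push_cast
  ring

/-! ## Markov chains driven by independent noise -/

section Chain

variable {V R R' : Type*} [MeasurableSpace V] [MeasurableSpace R] [MeasurableSpace R']

/-- The trajectory of the recursion `v (ℓ + 1) = Ψ ℓ (v ℓ) (r ℓ)` started at `v₀`. -/
def chain {V R : Type*} (Ψ : ℕ → V → R → V) (v₀ : V) (r : ℕ → R) : ℕ → V
  | 0 => v₀
  | ℓ + 1 => Ψ ℓ (chain Ψ v₀ r ℓ) (r ℓ)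

lemma measurable_chain {Ψ : ℕ → V → R → V} (hΨ : ∀ ℓ, Measurable fun p : V × R => Ψ ℓ p.1 p.2)
    (ℓ : ℕ) : Measurable fun p : V × (ℕ → R) => chain Ψ p.1 p.2 ℓ := by
  induction ℓ with
  | zero => exact measurable_fst
  | succ ℓ ih => exact (hΨ ℓ).comp (ih.prodMk ((measurable_pi_apply ℓ).comp measurable_snd))

/-- The state at time `ℓ` uses only the noise of times below `ℓ`; this yields its independence from
`r ℓ` in `map_chain_succ`. -/
lemma measurable_chain_past {Ψ : ℕ → V → R → V}
    (hΨ : ∀ ℓ, Measurable fun p : V × R => Ψ ℓ p.1 p.2) (v₀ : V) (ℓ : ℕ) :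
    Measurable[⨆ i ∈ Set.Iio ℓ, MeasurableSpace.comap (fun r : ℕ → R => r i) inferInstance]
      fun r : ℕ → R => chain Ψ v₀ r ℓ := by
  induction ℓ with
  | zero => exact measurable_const
  | succ ℓ ih =>
    have h1 : Measurable[⨆ i ∈ Set.Iio (ℓ + 1),
        MeasurableSpace.comap (fun r : ℕ → R => r i) inferInstance]
        fun r : ℕ → R => chain Ψ v₀ r ℓ :=
      ih.mono (biSup_mono fun i (hi : i < ℓ) => Nat.lt_succ_of_lt hi) le_rfl
    have h2 : Measurable[⨆ i ∈ Set.Iio (ℓ + 1),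
        MeasurableSpace.comap (fun r : ℕ → R => r i) inferInstance]
        fun r : ℕ → R => r ℓ :=
      (comap_measurable _).mono (le_biSup (fun i =>
        MeasurableSpace.comap (fun r : ℕ → R => r i) inferInstance)
        (show ℓ ∈ Set.Iio (ℓ + 1) from Nat.lt_succ_self ℓ)) le_rfl
    exact (hΨ ℓ).comp (h1.prodMk h2)

lemma map_chain_succ {Ψ : ℕ → V → R → V} (hΨ : ∀ ℓ, Measurable fun p : V × R => Ψ ℓ p.1 p.2)
    (v₀ : V) (ρ : Measure R) [IsProbabilityMeasure ρ] (ℓ : ℕ) :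
    (Measure.infinitePi fun _ : ℕ => ρ).map (fun r => chain Ψ v₀ r (ℓ + 1)) =
      (((Measure.infinitePi fun _ : ℕ => ρ).map (fun r => chain Ψ v₀ r ℓ)).prod ρ).map
        (fun p => Ψ ℓ p.1 p.2) := by
  have hm : Measurable fun r : ℕ → R => chain Ψ v₀ r ℓ :=
    (measurable_chain hΨ ℓ).comp measurable_prodMk_left
  have hi : iIndep (fun i : ℕ => MeasurableSpace.comap (fun r : ℕ → R => r i) inferInstance)
      (Measure.infinitePi fun _ : ℕ => ρ) :=
    iIndepFun_infinitePi (P := fun _ : ℕ => ρ) (X := fun _ r => r) fun _ => measurable_id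
  have hind : IndepFun (fun r : ℕ → R => chain Ψ v₀ r ℓ) (fun r : ℕ → R => r ℓ)
      (Measure.infinitePi fun _ : ℕ => ρ) := by
    have h := indep_iSup_of_disjoint (fun i => (measurable_pi_apply i).comap_le) hi
      (S := Set.Iio ℓ) (T := {ℓ}) (by simp)
    refine indep_of_indep_of_le_left (indep_of_indep_of_le_right h ?_) ?_
    · exact le_biSup (fun i => MeasurableSpace.comap (fun r : ℕ → R => r i) inferInstance)
        (Set.mem_singleton ℓ)
    · exact (measurable_chain_past hΨ v₀ ℓ).comap_le
  rw [indepFun_iff_map_prod_eq_prod_map_map hm.aemeasurable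
    (measurable_pi_apply ℓ).aemeasurable, Measure.infinitePi_map_eval] at hind
  rw [← hind, Measure.map_map (hΨ ℓ) (hm.prodMk (measurable_pi_apply ℓ))]
  rfl

lemma map_prod_congr {Y : Type*} [MeasurableSpace Y] (μ : Measure V) (ρ : Measure R)
    [IsProbabilityMeasure ρ] (ρ' : Measure R') [IsProbabilityMeasure ρ']
    {Ψ : V → R → Y} {Ψ' : V → R' → Y} (hΨ : Measurable fun p : V × R => Ψ p.1 p.2)
    (hΨ' : Measurable fun p : V × R' => Ψ' p.1 p.2)
    (h : ∀ v, ρ.map (Ψ v) = ρ'.map (Ψ' v)) :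
    (μ.prod ρ).map (fun p => Ψ p.1 p.2) = (μ.prod ρ').map (fun p => Ψ' p.1 p.2) := by
  ext s hs
  rw [Measure.map_apply hΨ hs, Measure.map_apply hΨ' hs, Measure.prod_apply (hΨ hs),
    Measure.prod_apply (hΨ' hs)]
  refine lintegral_congr fun v => ?_
  have h1 : Measurable (Ψ v) := hΨ.comp (measurable_const.prodMk measurable_id)
  have h2 : Measurable (Ψ' v) := hΨ'.comp (measurable_const.prodMk measurable_id)
  have := congrArg (fun m => m s) (h v)
  rw [Measure.map_apply h1 hs, Measure.map_apply h2 hs] at this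
  exact this

/-- The law of a chain depends only on its transition laws, not on the noise realizing them, since
each step uses noise independent of the current state. -/
lemma map_chain_congr (ρ : Measure R) [IsProbabilityMeasure ρ] (ρ' : Measure R')
    [IsProbabilityMeasure ρ'] {Ψ : ℕ → V → R → V} {Ψ' : ℕ → V → R' → V}
    (hΨ : ∀ ℓ, Measurable fun p : V × R => Ψ ℓ p.1 p.2)
    (hΨ' : ∀ ℓ, Measurable fun p : V × R' => Ψ' ℓ p.1 p.2)
    (h : ∀ ℓ v, ρ.map (Ψ ℓ v) = ρ'.map (Ψ' ℓ v)) (v₀ : V) (ℓ : ℕ) :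
    (Measure.infinitePi fun _ : ℕ => ρ).map (fun r => chain Ψ v₀ r ℓ) =
      (Measure.infinitePi fun _ : ℕ => ρ').map (fun r => chain Ψ' v₀ r ℓ) := by
  induction ℓ with
  | zero => simp [chain]
  | succ ℓ ih =>
    rw [map_chain_succ hΨ, map_chain_succ hΨ', ih]
    exact map_prod_congr _ _ _ (hΨ ℓ) (hΨ' ℓ) (h ℓ)

lemma map_prod_chain_congr {Y : Type*} [MeasurableSpace Y] (μ : Measure V) (ρ : Measure R)
    [IsProbabilityMeasure ρ] (ρ' : Measure R') [IsProbabilityMeasure ρ'] {Ψ : ℕ → V → R → V}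
    {Ψ' : ℕ → V → R' → V} (hΨ : ∀ ℓ, Measurable fun p : V × R => Ψ ℓ p.1 p.2)
    (hΨ' : ∀ ℓ, Measurable fun p : V × R' => Ψ' ℓ p.1 p.2)
    (h : ∀ ℓ v, ρ.map (Ψ ℓ v) = ρ'.map (Ψ' ℓ v)) (ℓ : ℕ) {g : V → Y} (hg : Measurable g) :
    (μ.prod (Measure.infinitePi fun _ : ℕ => ρ)).map (fun p => g (chain Ψ p.1 p.2 ℓ)) =
      (μ.prod (Measure.infinitePi fun _ : ℕ => ρ')).map (fun p => g (chain Ψ' p.1 p.2 ℓ)) := by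
  refine map_prod_congr μ _ _ (Ψ := fun v r => g (chain Ψ v r ℓ))
    (Ψ' := fun v r => g (chain Ψ' v r ℓ)) (hg.comp (measurable_chain hΨ ℓ))
    (hg.comp (measurable_chain hΨ' ℓ)) fun v => ?_
  have h1 : Measurable fun r => chain Ψ v r ℓ :=
    (measurable_chain hΨ ℓ).comp measurable_prodMk_left
  have h2 : Measurable fun r => chain Ψ' v r ℓ :=
    (measurable_chain hΨ' ℓ).comp measurable_prodMk_left
  have h3 := congrArg (Measure.map g) (map_chain_congr ρ ρ' hΨ hΨ' h v ℓ)
  rwa [Measure.map_map hg h1, Measure.map_map hg h2] at h3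

end Chain

/-! ## The network as a chain -/

/-- The nonlinearity applied before layer `ℓ + 1`: none at the input layer. -/
def layerAct (σ : ℝ → ℝ) : ℕ → ℝ → ℝ
  | 0 => id
  | _ + 1 => σ

lemma continuous_layerAct {σ : ℝ → ℝ} (hσ : Continuous σ) : ∀ ℓ, Continuous (layerAct σ ℓ)
  | 0 => continuous_id
  | _ + 1 => hσ

/-- One network layer, at `N` inputs simultaneously. -/
def netStep (N : ℕ) (σ : ℝ → ℝ) (ξ : ℝ) (n : ℕ → ℕ) (ℓ : ℕ) (v : ℕ → Fin N → ℝ)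
    (r : ℕ → Option ℕ → ℝ) (j : ℕ) : Fin N → ℝ :=
  affineRow ξ (n ℓ) (fun k a => layerAct σ ℓ (v k a)) (r j)

/-- A layer of independent Gaussian vectors having the conditional law of a network layer. -/
def gaussStep (N : ℕ) (σ : ℝ → ℝ) (ξ : ℝ) (n : ℕ → ℕ) (ℓ : ℕ) (v : ℕ → Fin N → ℝ)
    (ζ : ℕ → EuclideanSpace ℝ (Fin N)) (j : ℕ) : Fin N → ℝ :=
  WithLp.ofLp (covRoot (empCov ξ (n ℓ) fun k a => layerAct σ ℓ (v k a)) (ζ j))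

/-- The standard normal law of the weights and biases of one layer. -/
def weightLaw : Measure (ℕ → Option ℕ → ℝ) :=
  Measure.infinitePi fun _ => Measure.infinitePi fun _ => gaussianReal 0 1

/-- The law of a sequence of independent standard Gaussian vectors. -/
def noiseLaw (N : ℕ) : Measure (ℕ → EuclideanSpace ℝ (Fin N)) :=
  Measure.infinitePi fun _ => stdGaussian (EuclideanSpace ℝ (Fin N))

instance : IsProbabilityMeasure weightLaw := by unfold weightLaw; infer_instance

instance (N : ℕ) : IsProbabilityMeasure (noiseLaw N) := by unfold noiseLaw; infer_instance

lemma measurable_layerAct_family {N : ℕ} {σ : ℝ → ℝ} (hσ : Continuous σ) (ℓ : ℕ) :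
    Measurable fun (v : ℕ → Fin N → ℝ) (k : ℕ) (a : Fin N) => layerAct σ ℓ (v k a) := by
  refine measurable_pi_lambda _ fun k => measurable_pi_lambda _ fun a => ?_
  exact (continuous_layerAct hσ ℓ).measurable.comp
    ((measurable_pi_apply a).comp (measurable_pi_apply k))

lemma measurable_netStep (N : ℕ) {σ : ℝ → ℝ} (hσ : Continuous σ) (ξ : ℝ) (n : ℕ → ℕ) (ℓ : ℕ) :
    Measurable fun p : (ℕ → Fin N → ℝ) × (ℕ → Option ℕ → ℝ) => netStep N σ ξ n ℓ p.1 p.2 := by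
  refine measurable_pi_lambda _ fun j => ?_
  exact (measurable_affineRow ξ (n ℓ)).comp
    (((measurable_layerAct_family hσ ℓ).comp measurable_fst).prodMk
      ((measurable_pi_apply j).comp measurable_snd))

lemma measurable_gaussStep (N : ℕ) {σ : ℝ → ℝ} (hσ : Continuous σ) (ξ : ℝ) (n : ℕ → ℕ) (ℓ : ℕ) :
    Measurable fun p : (ℕ → Fin N → ℝ) × (ℕ → EuclideanSpace ℝ (Fin N)) =>
      gaussStep N σ ξ n ℓ p.1 p.2 := by
  refine measurable_pi_lambda _ fun j => ?_
  have h1 : Measurable fun p : (ℕ → Fin N → ℝ) × (ℕ → EuclideanSpace ℝ (Fin N)) =>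
      empCov ξ (n ℓ) fun k a => layerAct σ ℓ (p.1 k a) :=
    (continuous_empCov ξ (n ℓ)).measurable.comp
      ((measurable_layerAct_family hσ ℓ).comp measurable_fst)
  have h2 : Measurable fun p : (ℕ → Fin N → ℝ) × (ℕ → EuclideanSpace ℝ (Fin N)) => p.2 j :=
    (measurable_pi_apply j).comp measurable_snd
  exact (WithLp.measurable_ofLp 2 (Fin N → ℝ)).comp (h1.covRoot h2)

/-- Distinct neurons use disjoint independent noise, so both sides are product measures over `j`,
and `map_affineRow` matches the factors. -/
lemma map_netStep_eq_map_gaussStep (N : ℕ) (σ : ℝ → ℝ) (ξ : ℝ) (n : ℕ → ℕ) (ℓ : ℕ)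
    (v : ℕ → Fin N → ℝ) :
    weightLaw.map (netStep N σ ξ n ℓ v) = (noiseLaw N).map (gaussStep N σ ξ n ℓ v) := by
  have h1 : Measurable (affineRow ξ (n ℓ) fun k a => layerAct σ ℓ (v k a)) :=
    (measurable_affineRow ξ (n ℓ)).comp (measurable_const.prodMk measurable_id)
  have h2 := WithLp.measurable_ofLp 2 (Fin N → ℝ)
  have h3 := (continuous_covRoot (empCov ξ (n ℓ) fun k a => layerAct σ ℓ (v k a))).measurable
  unfold weightLaw noiseLaw netStep gaussStep
  rw [Measure.infinitePi_map_pi _ fun _ => h1]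
  refine Eq.trans ?_ (Measure.infinitePi_map_pi _ fun _ => h2.comp h3).symm
  congr 1
  ext1 j
  rw [← Measure.map_map h2 h3, map_covRoot_stdGaussian,
    ← map_affineRow]
  exact (Measure.map_map h2 ((WithLp.measurable_toLp 2 _).comp h1)).symm

/-- Stated from layer 1 on: `preact` at 0 is a placeholder, whereas the chain starts at the features
themselves. -/
lemma preact_eq_chain {N : ℕ} (σ : ℝ → ℝ) (ξ : ℝ) (n : ℕ → ℕ) (W : ℕ → ℕ → ℕ → ℝ)
    (b : ℕ → ℕ → ℝ) (q : ℕ → Fin N → ℝ) (a : Fin N) (ℓ : ℕ) : ∀ j,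
    preact σ ξ n W b (fun i => q i a) (ℓ + 1) j =
      chain (netStep N σ ξ n) q (fun ℓ j o => o.elim (b ℓ j) (W ℓ j)) (ℓ + 1) j a := by
  induction ℓ with
  | zero => intro j; rfl
  | succ ℓ ih =>
    intro j
    rw [preact, chain, netStep, affineRow]
    simp only [ih]
    rfl

/-! ### The output law in terms of independent Gaussian noise -/

namespace IsInitialization

variable {X Ω : Type*} [MeasurableSpace Ω] {nQ m : ℕ}
  {ν : Fin nQ → Measure (BlockUnitary m)} {P : Measure Ω}
  {U : ℕ → Fin nQ → Ω → BlockUnitary m} {W : ℕ → ℕ → ℕ → Ω → ℝ} {b : ℕ → ℕ → Ω → ℝ}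

lemma map_weights (hI : IsInitialization ν P U W b) :
    P.map (fun ω (ℓ j : ℕ) (o : Option ℕ) => o.elim (b ℓ j ω) fun k => W ℓ j k ω) =
      Measure.infinitePi fun _ : ℕ => weightLaw := by
  -- Reindexing by layer, neuron and input slot, with `none` for the bias; injectivity carries
  -- independence over to the new index.
  set f : (ℕ × ℕ) × Option ℕ → ℕ × ℕ × ℕ ⊕ ℕ × ℕ :=
    fun p => p.2.elim (Sum.inr p.1) fun k => Sum.inl (p.1.1, p.1.2, k) with hf
  have hfinj : Function.Injective f := by
    rintro ⟨⟨ℓ, j⟩, _ | k⟩ ⟨⟨ℓ', j'⟩, _ | k'⟩ h <;> simp_all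
  have h1 := hI.indep_Wb.precomp hfinj
  have hlaw : ∀ p, HasLaw (Sum.elim (fun p : ℕ × ℕ × ℕ => W p.1 p.2.1 p.2.2)
      (fun p : ℕ × ℕ => b p.1 p.2) (f p)) (gaussianReal 0 1) P := by
    rintro ⟨⟨ℓ, j⟩, _ | k⟩
    · exact hI.law_b ℓ j
    · exact hI.law_W ℓ j k
  have hmeas : ∀ p, Measurable (Sum.elim (fun p : ℕ × ℕ × ℕ => W p.1 p.2.1 p.2.2)
      (fun p : ℕ × ℕ => b p.1 p.2) (f p)) := by
    rintro ⟨⟨ℓ, j⟩, _ | k⟩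
    · exact hI.measurable_b ℓ j
    · exact hI.measurable_W ℓ j k
  have h2 := (h1.hasLaw_infinitePi hlaw (measurable_pi_lambda _ hmeas).aemeasurable).map_eq
  have h3 : (fun ω (ℓ j : ℕ) (o : Option ℕ) => o.elim (b ℓ j ω) fun k => W ℓ j k ω) =
      MeasurableEquiv.curry ℕ ℕ (Option ℕ → ℝ) ∘ MeasurableEquiv.curry (ℕ × ℕ) (Option ℕ) ℝ ∘
      fun ω p => Sum.elim (fun p : ℕ × ℕ × ℕ => W p.1 p.2.1 p.2.2)
        (fun p : ℕ × ℕ => b p.1 p.2) (f p) ω := by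
    ext ω ℓ j o
    cases o <;> rfl
  rw [h3, ← Measure.map_map (by fun_prop) (by fun_prop),
    ← Measure.map_map (by fun_prop) (measurable_pi_lambda _ hmeas), h2,
    Measure.infinitePi_map_curry (fun (_ : ℕ × ℕ) (_ : Option ℕ) => gaussianReal 0 1),
    Measure.infinitePi_map_curry
      (fun (_ : ℕ) (_ : ℕ) => Measure.infinitePi fun _ : Option ℕ => gaussianReal 0 1)]
  rfl

lemma measurable_features (hI : IsInitialization ν P U W b)
    (Uenc : X → Matrix.unitaryGroup (Register nQ m) ℂ) (𝒪 : Matrix (Block m) (Block m) ℂ) {N : ℕ}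
    (x : Fin N → X) : Measurable fun ω (i : ℕ) (a : Fin N) =>
      quantumFeature Uenc 𝒪 (fun k => U i k ω) (x a) :=
  measurable_pi_lambda _ fun i => measurable_pi_lambda _ fun a =>
    measurable_quantumFeature Uenc 𝒪 (x a) (hI.measurable_U i)

lemma indepFun_features_weights (hI : IsInitialization ν P U W b)
    (Uenc : X → Matrix.unitaryGroup (Register nQ m) ℂ) (𝒪 : Matrix (Block m) (Block m) ℂ) {N : ℕ}
    (x : Fin N → X) :
    IndepFun (fun ω (i : ℕ) (a : Fin N) => quantumFeature Uenc 𝒪 (fun k => U i k ω) (x a))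
      (fun ω (ℓ j : ℕ) (o : Option ℕ) => o.elim (b ℓ j ω) fun k => W ℓ j k ω) P := by
  have h1 : Measurable fun (u : ℕ × Fin nQ → BlockUnitary m) (i : ℕ) (a : Fin N) =>
      quantumFeature Uenc 𝒪 (fun k => u (i, k)) (x a) :=
    measurable_pi_lambda _ fun i => measurable_pi_lambda _ fun a =>
      measurable_quantumFeature Uenc 𝒪 (x a)
        (V := fun k (u : ℕ × Fin nQ → BlockUnitary m) => u (i, k))
        fun k => measurable_pi_apply (i, k)
  have h2 : Measurable fun (w : ℕ × ℕ × ℕ ⊕ ℕ × ℕ → ℝ) (ℓ j : ℕ) (o : Option ℕ) =>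
      o.elim (w (Sum.inr (ℓ, j))) fun k => w (Sum.inl (ℓ, j, k)) := by
    refine measurable_pi_lambda _ fun ℓ => measurable_pi_lambda _ fun j =>
      measurable_pi_lambda _ fun o => ?_
    cases o with
    | none => exact measurable_pi_apply _
    | some k => exact measurable_pi_apply _
  exact hI.indep_U_Wb.comp h1 h2

lemma outputLaw_eq_map_netStep [IsProbabilityMeasure P] (hI : IsInitialization ν P U W b)
    (Uenc : X → Matrix.unitaryGroup (Register nQ m) ℂ) (𝒪 : Matrix (Block m) (Block m) ℂ)
    {σ : ℝ → ℝ} (hσ : Continuous σ) (ξ : ℝ) (L : ℕ) {N : ℕ} (x : Fin N → X) (n : ℕ → ℕ) :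
    (outputLaw hI Uenc 𝒪 hσ.measurable ξ (L + 1) x n : Measure (EuclideanSpace ℝ (Fin N))) =
      ((P.map fun ω (i : ℕ) (a : Fin N) => quantumFeature Uenc 𝒪 (fun k => U i k ω) (x a)).prod
        (Measure.infinitePi fun _ : ℕ => weightLaw)).map
          fun p => WithLp.toLp 2 (chain (netStep N σ ξ n) p.1 p.2 (L + 1) 0) := by
  have hqm := hI.measurable_features Uenc 𝒪 x
  have hTm : Measurable fun ω (ℓ j : ℕ) (o : Option ℕ) =>
      o.elim (b ℓ j ω) fun k => W ℓ j k ω := by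
    refine measurable_pi_lambda _ fun ℓ => measurable_pi_lambda _ fun j =>
      measurable_pi_lambda _ fun o => ?_
    cases o with
    | none => exact hI.measurable_b ℓ j
    | some k => exact hI.measurable_W ℓ j k
  have hc : Measurable fun p : (ℕ → Fin N → ℝ) × (ℕ → ℕ → Option ℕ → ℝ) =>
      WithLp.toLp 2 (chain (netStep N σ ξ n) p.1 p.2 (L + 1) 0) :=
    (WithLp.measurable_toLp 2 (Fin N → ℝ)).comp ((measurable_pi_apply 0).comp
      (measurable_chain (measurable_netStep N hσ ξ n) (L + 1)))
  rw [← hI.map_weights, ← (indepFun_iff_map_prod_eq_prod_map_map hqm.aemeasurable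
    hTm.aemeasurable).mp (hI.indepFun_features_weights Uenc 𝒪 x),
    Measure.map_map hc (hqm.prodMk hTm)]
  refine congrArg (fun f => Measure.map f P) ?_
  ext ω a
  exact preact_eq_chain σ ξ n (fun ℓ j k => W ℓ j k ω) (fun ℓ j => b ℓ j ω)
    (fun i a => quantumFeature Uenc 𝒪 (fun k => U i k ω) (x a)) a L 0

/-- The coupling: all widths share one probability space, and a layer's width enters only through an
empirical covariance, to which the strong law applies pathwise. -/
lemma outputLaw_eq_map_gaussStep [IsProbabilityMeasure P] (hI : IsInitialization ν P U W b)
    (Uenc : X → Matrix.unitaryGroup (Register nQ m) ℂ) (𝒪 : Matrix (Block m) (Block m) ℂ)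
    {σ : ℝ → ℝ} (hσ : Continuous σ) (ξ : ℝ) (L : ℕ) {N : ℕ} (x : Fin N → X) (n : ℕ → ℕ) :
    (outputLaw hI Uenc 𝒪 hσ.measurable ξ (L + 1) x n : Measure (EuclideanSpace ℝ (Fin N))) =
      (P.prod (Measure.infinitePi fun _ : ℕ => noiseLaw N)).map fun p => WithLp.toLp 2
        (chain (gaussStep N σ ξ n)
          (fun i a => quantumFeature Uenc 𝒪 (fun k => U i k p.1) (x a)) p.2 (L + 1) 0) := by
  have hqm := hI.measurable_features Uenc 𝒪 x
  have hev : Measurable fun v : ℕ → Fin N → ℝ => WithLp.toLp 2 (v 0) :=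
    (WithLp.measurable_toLp 2 (Fin N → ℝ)).comp (measurable_pi_apply 0)
  have hg := measurable_gaussStep N hσ ξ n
  rw [hI.outputLaw_eq_map_netStep Uenc 𝒪 hσ,
    map_prod_chain_congr _ weightLaw (noiseLaw N) (measurable_netStep N hσ ξ n) hg
      (map_netStep_eq_map_gaussStep N σ ξ n) (L + 1) hev]
  have h := Measure.map_prod_map P (Measure.infinitePi fun _ : ℕ => noiseLaw N) hqm measurable_id
  rw [Measure.map_id] at h
  rw [h]
  exact Measure.map_map (hev.comp (measurable_chain hg (L + 1))) (hqm.prodMap measurable_id)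

end IsInitialization

/-! ## Second moments of Lipschitz functions of Gaussian vectors -/

lemma LipschitzWith.memLp_comp {Ω : Type*} [MeasurableSpace Ω] {μ : Measure Ω} [IsFiniteMeasure μ]
    {σ : ℝ → ℝ} {C : NNReal} (hσ : LipschitzWith C σ) {f : Ω → ℝ} {p : ENNReal}
    (hf : MemLp f p μ) : MemLp (fun ω => σ (f ω)) p μ := by
  -- Subtracting `σ 0` makes the function vanish at 0, so it is dominated by `C * |t|`; the constant
  -- is restored using finiteness of `μ`.
  have h0 : LipschitzWith C fun t => σ t - σ 0 := by
    simpa using hσ.sub (LipschitzWith.const (σ 0))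
  have h1 : MemLp ((fun t => σ t - σ 0) ∘ f) p μ := h0.comp_memLp (by simp) hf
  have h2 := h1.add (memLp_const (σ 0))
  refine h2.congr_norm (hσ.continuous.comp_aestronglyMeasurable hf.1) ?_
  exact Eventually.of_forall fun ω => by simp

lemma memLp_eval_multivariateGaussian {N : ℕ} (S : Matrix (Fin N) (Fin N) ℝ) (a : Fin N) :
    MemLp (fun h : EuclideanSpace ℝ (Fin N) => h a) 2 (multivariateGaussian 0 S) := by
  have h := (EuclideanSpace.proj a : EuclideanSpace ℝ (Fin N) →L[ℝ] ℝ).comp_memLp'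
    (IsGaussian.memLp_two_id (μ := multivariateGaussian 0 S))
  exact h

/-- The quadratic form at `t` is `E[(∑ t_a g_a)²] + (ξ ∑ t_a)²`. Used for the first covariance and
for the recursion alike. -/
lemma posSemidef_integral_mul_add_sq {Ω : Type*} [MeasurableSpace Ω] {μ : Measure Ω} {N : ℕ}
    {g : Fin N → Ω → ℝ} (hg : ∀ a, MemLp (g a) 2 μ) (ξ : ℝ) :
    (Matrix.of fun a c => ∫ ω, g a ω * g c ω ∂μ + ξ ^ 2).PosSemidef := by
  rw [posSemidef_iff_dotProduct_mulVec]
  refine ⟨?_, fun t => ?_⟩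
  · ext a c
    simp [mul_comm]
  have hi : ∀ a c, Integrable (fun ω => t a * (g a ω * g c ω * t c)) μ := fun a c =>
    (((hg a).integrable_mul (hg c)).mul_const _).const_mul _
  have h1 : ∫ ω, (∑ a, t a * g a ω) ^ 2 ∂μ =
      ∑ a, ∑ c, t a * ((∫ ω, g a ω * g c ω ∂μ) * t c) := by
    have : ∀ ω, (∑ a, t a * g a ω) ^ 2 = ∑ a, ∑ c, t a * (g a ω * g c ω * t c) := fun ω => by
      rw [sq, Finset.sum_mul_sum]
      exact Finset.sum_congr rfl fun a _ => Finset.sum_congr rfl fun c _ => by ring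
    simp only [this]
    rw [integral_finsetSum _ fun a _ => integrable_finsetSum _ fun c _ => hi a c]
    refine Finset.sum_congr rfl fun a _ => ?_
    rw [integral_finsetSum _ fun c _ => hi a c]
    refine Finset.sum_congr rfl fun c _ => ?_
    rw [integral_const_mul, integral_mul_const]
  have h2 : (∑ a, t a * ξ) ^ 2 = ∑ a, ∑ c, t a * (ξ ^ 2 * t c) := by
    rw [sq, Finset.sum_mul_sum]
    exact Finset.sum_congr rfl fun a _ => Finset.sum_congr rfl fun c _ => by ring
  have h3 : star t ⬝ᵥ (Matrix.of fun a c => ∫ ω, g a ω * g c ω ∂μ + ξ ^ 2) *ᵥ t =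
      ∫ ω, (∑ a, t a * g a ω) ^ 2 ∂μ + (∑ a, t a * ξ) ^ 2 := by
    rw [h1, h2, star_trivial, ← Finset.sum_add_distrib]
    simp only [dotProduct, mulVec, Matrix.of_apply]
    refine Finset.sum_congr rfl fun a _ => ?_
    rw [← Finset.sum_add_distrib, Finset.mul_sum]
    exact Finset.sum_congr rfl fun c _ => by ring
  rw [h3]
  exact add_nonneg (integral_nonneg fun ω => sq_nonneg _) (sq_nonneg _)

/-- Both sides are Gaussian with equal means and covariances. The map `e` may repeat indices, which
is needed for the pair `(x a, x a)`. -/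
lemma map_comp_multivariateGaussian {N M : ℕ} {S : Matrix (Fin N) (Fin N) ℝ} (hS : S.PosSemidef)
    (e : Fin M → Fin N) :
    (multivariateGaussian 0 S).map (fun h => WithLp.toLp 2 fun i => h (e i)) =
      multivariateGaussian 0 (S.submatrix e e) := by
  set T : EuclideanSpace ℝ (Fin N) →L[ℝ] EuclideanSpace ℝ (Fin M) :=
    LinearMap.toContinuousLinearMap
      { toFun := fun h => WithLp.toLp 2 fun i => h (e i)
        map_add' := fun _ _ => rfl
        map_smul' := fun _ _ => rfl } with hT
  change (multivariateGaussian 0 S).map T = _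
  apply IsGaussian.ext
  · simp only [id_eq, integral_id_multivariateGaussian]
    rw [ContinuousLinearMap.integral_id_map IsGaussian.integrable_id,
      integral_id_multivariateGaussian, map_zero]
  rw [← ContinuousLinearMap.toBilinForm_inj]
  refine LinearMap.BilinForm.ext_basis (EuclideanSpace.basisFun (Fin M) ℝ).toBasis fun i j ↦ ?_
  rw [ContinuousLinearMap.toBilinForm_apply, ContinuousLinearMap.toBilinForm_apply,
    covarianceBilin_apply_eq_cov IsGaussian.memLp_two_id, covariance_map
      (Measurable.aestronglyMeasurable (by fun_prop))
      (Measurable.aestronglyMeasurable (by fun_prop)) (by fun_prop)]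
  have h : ∀ i : Fin M, (fun u ↦ inner ℝ ((EuclideanSpace.basisFun (Fin M) ℝ).toBasis i) u) ∘ T =
      fun u ↦ u (e i) := fun i => by
    ext u
    simp only [Function.comp_apply, OrthonormalBasis.coe_toBasis, EuclideanSpace.basisFun_apply,
      EuclideanSpace.inner_single_left, map_one, one_mul]
    rfl
  simp_rw [h, covariance_eval_multivariateGaussian hS,
    covarianceBilin_multivariateGaussian (hS.submatrix _)]
  simp

/-! ### Gram matrices of kernels and the covariance recursion -/

section Kernel

variable {X : Type*} {K : X → X → ℝ}

lemma gaussianPair_eq_map (hK : ∀ (N : ℕ) (x : Fin N → X), (gramMatrix K x).PosSemidef) {N : ℕ}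
    (x : Fin N → X) (a c : Fin N) :
    gaussianPair K (x a) (x c) =
      (multivariateGaussian 0 (gramMatrix K x)).map fun h => WithLp.toLp 2 ![h a, h c] := by
  have h := map_comp_multivariateGaussian (hK N x) ![a, c]
  have h1 : (fun h : EuclideanSpace ℝ (Fin N) => WithLp.toLp 2 fun i => h (![a, c] i)) =
      fun h => WithLp.toLp 2 ![h a, h c] := by
    ext h i
    fin_cases i <;> rfl
  have h2 : (gramMatrix K x).submatrix ![a, c] ![a, c] =
      !![K (x a) (x a), K (x a) (x c); K (x c) (x a), K (x c) (x c)] := by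
    ext i j
    fin_cases i <;> fin_cases j <;> rfl
  rw [h1, h2] at h
  exact h.symm

lemma integrable_gaussianPair {σ : ℝ → ℝ} {C : NNReal} (hσ : LipschitzWith C σ) (x x' : X) :
    Integrable (fun h : EuclideanSpace ℝ (Fin 2) => σ (h 0) * σ (h 1)) (gaussianPair K x x') :=
  (hσ.memLp_comp (memLp_eval_multivariateGaussian _ 0)).integrable_mul
    (hσ.memLp_comp (memLp_eval_multivariateGaussian _ 1))

/-- The recursion is defined through two-dimensional Gaussians, while the limits produce
`N`-dimensional ones; this identifies the two. -/
lemma integral_gaussianPair (hK : ∀ (N : ℕ) (x : Fin N → X), (gramMatrix K x).PosSemidef)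
    {σ : ℝ → ℝ} (hσ : Continuous σ) {N : ℕ} (x : Fin N → X) (a c : Fin N) :
    ∫ h, σ (h 0) * σ (h 1) ∂(gaussianPair K (x a) (x c)) =
      ∫ h, σ (h a) * σ (h c) ∂(multivariateGaussian 0 (gramMatrix K x)) := by
  rw [gaussianPair_eq_map hK, integral_map]
  · rfl
  · refine Measurable.aemeasurable ?_
    refine (WithLp.measurable_toLp 2 (Fin 2 → ℝ)).comp (measurable_pi_lambda _ fun i => ?_)
    fin_cases i
    · exact (by fun_prop : Measurable fun h : EuclideanSpace ℝ (Fin N) => h a)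
    · exact (by fun_prop : Measurable fun h : EuclideanSpace ℝ (Fin N) => h c)
  · exact Continuous.aestronglyMeasurable (by fun_prop)

lemma posSemidef_gramMatrix_succ (hK : ∀ (N : ℕ) (x : Fin N → X), (gramMatrix K x).PosSemidef)
    {σ : ℝ → ℝ} {C : NNReal} (hσ : LipschitzWith C σ) (ξ : ℝ) {N : ℕ} (x : Fin N → X) :
    (gramMatrix (fun x x' => ∫ h, σ (h 0) * σ (h 1) ∂(gaussianPair K x x') + ξ ^ 2)
      x).PosSemidef := by
  simp only [gramMatrix, integral_gaussianPair hK hσ.continuous x]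
  exact posSemidef_integral_mul_add_sq
    (fun a => hσ.memLp_comp (memLp_eval_multivariateGaussian (gramMatrix K x) a)) ξ

end Kernel

/-! ## The law of large numbers for empirical covariances -/

lemma ae_tendsto_empCov {Ω : Type*} [MeasurableSpace Ω] {μ : Measure Ω} {N : ℕ} (ξ : ℝ)
    {w : ℕ → Ω → Fin N → ℝ} (hind : Pairwise fun i j => IndepFun (w i) (w j) μ)
    (hid : ∀ i, IdentDistrib (w i) (w 0) μ μ) (hw : ∀ a, MemLp (fun ω => w 0 ω a) 2 μ) :
    ∀ᵐ ω ∂μ, Tendsto (fun n => empCov ξ n fun k => w k ω) atTop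
      (𝓝 (Matrix.of fun a c => ∫ ω, w 0 ω a * w 0 ω c ∂μ + ξ ^ 2)) := by
  have hu : Measurable fun (y : Fin N → ℝ) (a c : Fin N) => y a * y c := by fun_prop
  have hi : ∀ a c, Integrable (fun ω => w 0 ω a * w 0 ω c) μ := fun a c =>
    (hw a).integrable_mul (hw c)
  have hi' : Integrable (fun ω (a c : Fin N) => w 0 ω a * w 0 ω c) μ :=
    Integrable.of_eval fun a => Integrable.of_eval fun c => hi a c
  -- The strong law is applied to the matrix-valued outer products, so all entries converge on one
  -- event of full measure.
  have h := strong_law_ae (μ := μ) (fun i ω (a c : Fin N) => w i ω a * w i ω c) hi'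
    (fun i j hij => (hind hij).comp hu hu) fun i => (hid i).comp hu
  filter_upwards [h] with ω hω
  refine tendsto_pi_nhds.mpr fun a => tendsto_pi_nhds.mpr fun c => ?_
  have h1 := ((tendsto_pi_nhds.mp (tendsto_pi_nhds.mp hω a) c)).add_const (ξ ^ 2)
  have h2 : (∫ ω, (fun (a c : Fin N) => w 0 ω a * w 0 ω c) ∂μ) a c =
      ∫ ω, w 0 ω a * w 0 ω c ∂μ := by
    rw [eval_integral fun a => Integrable.of_eval fun c => hi a c,
      eval_integral fun c => hi a c]
  rw [h2] at h1
  refine h1.congr fun n => ?_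
  simp [empCov, Finset.sum_apply]

/-! ## The output given the covariance of a layer -/

/-- The output after `d` further layers, when layer `ℓ + 1` is Gaussian with covariance `S`. -/
def gaussOut {N : ℕ} (σ : ℝ → ℝ) (ξ : ℝ) (n : ℕ → ℕ) :
    ℕ → ℕ → Matrix (Fin N) (Fin N) ℝ → (ℕ → ℕ → EuclideanSpace ℝ (Fin N)) →
      EuclideanSpace ℝ (Fin N)
  | 0, ℓ, S, ζ => covRoot S (ζ ℓ 0)
  | d + 1, ℓ, S, ζ => gaussOut σ ξ n d (ℓ + 1)
      (empCov ξ (n (ℓ + 1)) fun k a => σ (covRoot S (ζ ℓ k) a)) ζ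

/-- Only widths of index above `ℓ` enter, so sending an earlier width to infinity leaves the
remaining network untouched. -/
lemma gaussOut_congr {N : ℕ} (σ : ℝ → ℝ) (ξ : ℝ) {n n' : ℕ → ℕ} (d : ℕ) :
    ∀ (ℓ : ℕ) (S : Matrix (Fin N) (Fin N) ℝ) (ζ : ℕ → ℕ → EuclideanSpace ℝ (Fin N)),
      (∀ i, ℓ < i → n i = n' i) → gaussOut σ ξ n d ℓ S ζ = gaussOut σ ξ n' d ℓ S ζ := by
  induction d with
  | zero => intros; rfl
  | succ d ih =>
    intro ℓ S ζ h
    rw [gaussOut, gaussOut, h (ℓ + 1) (Nat.lt_succ_self ℓ)]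
    exact ih _ _ _ fun i hi => h i (by omega)

/-- The root is continuous only on the cone; the induction closes because every later `empCov` lies
in the cone again. -/
lemma continuousOn_gaussOut {N : ℕ} {σ : ℝ → ℝ} (hσ : Continuous σ) (ξ : ℝ) (n : ℕ → ℕ)
    (ζ : ℕ → ℕ → EuclideanSpace ℝ (Fin N)) (d : ℕ) : ∀ ℓ,
    ContinuousOn (fun S : Matrix (Fin N) (Fin N) ℝ => gaussOut σ ξ n d ℓ S ζ)
      {S | S.PosSemidef} := by
  have hc : ∀ ℓ k, ContinuousOn (fun S : Matrix (Fin N) (Fin N) ℝ => covRoot S (ζ ℓ k))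
      {S | S.PosSemidef} := fun ℓ k => by
    have h1 : ContinuousOn (fun S : Matrix (Fin N) (Fin N) ℝ => (S, ζ ℓ k))
      {S | S.PosSemidef} := by fun_prop
    exact continuousOn_covRoot.comp h1 fun S hS => hS
  induction d with
  | zero => intro ℓ; exact hc ℓ 0
  | succ d ih =>
    intro ℓ
    have h1 : ContinuousOn (fun S : Matrix (Fin N) (Fin N) ℝ =>
        fun (k : ℕ) (a : Fin N) => σ (covRoot S (ζ ℓ k) a)) {S | S.PosSemidef} := by
      refine continuousOn_pi.mpr fun k => continuousOn_pi.mpr fun a => ?_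
      have h2 : Continuous fun y : EuclideanSpace ℝ (Fin N) => σ (y a) := by fun_prop
      exact h2.comp_continuousOn (hc ℓ k)
    exact (ih (ℓ + 1)).comp ((continuous_empCov ξ (n (ℓ + 1))).comp_continuousOn h1)
      fun S _ => posSemidef_empCov ξ _ _

lemma measurable_gaussOut {N : ℕ} {σ : ℝ → ℝ} (hσ : Continuous σ) (ξ : ℝ) (n : ℕ → ℕ) (d : ℕ) :
    ∀ ℓ, Measurable fun p : Matrix (Fin N) (Fin N) ℝ × (ℕ → ℕ → EuclideanSpace ℝ (Fin N)) =>
      gaussOut σ ξ n d ℓ p.1 p.2 := by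
  have hc : ∀ ℓ k, Measurable fun p : Matrix (Fin N) (Fin N) ℝ ×
      (ℕ → ℕ → EuclideanSpace ℝ (Fin N)) => covRoot p.1 (p.2 ℓ k) := fun ℓ k =>
    measurable_fst.covRoot
      ((measurable_pi_apply k).comp ((measurable_pi_apply ℓ).comp measurable_snd))
  induction d with
  | zero => intro ℓ; exact hc ℓ 0
  | succ d ih =>
    intro ℓ
    have h1 : Measurable fun p : Matrix (Fin N) (Fin N) ℝ ×
        (ℕ → ℕ → EuclideanSpace ℝ (Fin N)) =>
        fun (k : ℕ) (a : Fin N) => σ (covRoot p.1 (p.2 ℓ k) a) := by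
      refine measurable_pi_lambda _ fun k => measurable_pi_lambda _ fun a => ?_
      have h2 : Continuous fun y : EuclideanSpace ℝ (Fin N) => σ (y a) := by fun_prop
      exact h2.measurable.comp (hc ℓ k)
    have h2 := (continuous_empCov ξ (n (ℓ + 1))).measurable.comp h1
    have h3 := (ih (ℓ + 1)).comp (h2.prodMk measurable_snd)
    exact h3

/-- For given later noise, the layers up to `ℓ` affect the output only through the empirical
covariance of layer `ℓ`. -/
lemma chain_gaussStep_eq_gaussOut {N : ℕ} (σ : ℝ → ℝ) (ξ : ℝ) (n : ℕ → ℕ) (q : ℕ → Fin N → ℝ)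
    (ζ : ℕ → ℕ → EuclideanSpace ℝ (Fin N)) (d : ℕ) : ∀ ℓ,
    WithLp.toLp 2 (chain (gaussStep N σ ξ n) q ζ (ℓ + d + 1) 0) =
      gaussOut σ ξ n d ℓ (empCov ξ (n ℓ) fun k a =>
        layerAct σ ℓ (chain (gaussStep N σ ξ n) q ζ ℓ k a)) ζ := by
  induction d with
  | zero => intro ℓ; rfl
  | succ d ih =>
    intro ℓ
    rw [show ℓ + (d + 1) + 1 = ℓ + 1 + d + 1 by omega, ih (ℓ + 1)]
    rfl

/-- The law of `gaussOut` under independent standard Gaussian noise. -/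
def gaussOutLaw {N : ℕ} {σ : ℝ → ℝ} (hσ : Continuous σ) (ξ : ℝ) (n : ℕ → ℕ) (d ℓ : ℕ)
    (S : Matrix (Fin N) (Fin N) ℝ) : ProbabilityMeasure (EuclideanSpace ℝ (Fin N)) :=
  ⟨(Measure.infinitePi fun _ : ℕ => noiseLaw N).map (gaussOut σ ξ n d ℓ S),
    Measure.isProbabilityMeasure_map
      ((measurable_gaussOut hσ ξ n d ℓ).comp measurable_prodMk_left).aemeasurable⟩

/-- The common limit step: almost sure convergence of the covariances passes through
`continuousOn_gaussOut` and gives convergence in law. `T` and `ζ` may be dependent: as `S` is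
deterministic, the limit law involves only the law of `ζ`. -/
lemma tendsto_law_gaussOut {Ω : Type*} [MeasurableSpace Ω] {μ : Measure Ω} [IsProbabilityMeasure μ]
    {N : ℕ} {σ : ℝ → ℝ} (hσ : Continuous σ) (ξ : ℝ) (n : ℕ → ℕ) (d ℓ : ℕ)
    {T : ℕ → Ω → Matrix (Fin N) (Fin N) ℝ} (hT : ∀ w, Measurable (T w))
    (hT' : ∀ w ω, (T w ω).PosSemidef) {S : Matrix (Fin N) (Fin N) ℝ} (hS : S.PosSemidef)
    {ζ : Ω → ℕ → ℕ → EuclideanSpace ℝ (Fin N)}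
    (hζ : MeasurePreserving ζ μ (Measure.infinitePi fun _ : ℕ => noiseLaw N))
    (hlim : ∀ᵐ ω ∂μ, Tendsto (fun w => T w ω) atTop (𝓝 S))
    {F : ℕ → ProbabilityMeasure (EuclideanSpace ℝ (Fin N))}
    (hF : ∀ w, (F w : Measure (EuclideanSpace ℝ (Fin N))) =
      μ.map fun ω => gaussOut σ ξ n d ℓ (T w ω) (ζ ω)) :
    Tendsto F atTop (𝓝 (gaussOutLaw hσ ξ n d ℓ S)) := by
  have hg := measurable_gaussOut (N := N) hσ ξ n d ℓ
  have h := tendstoInDistribution_of_ae_tendsto (l := atTop) (μ' := μ)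
    (X := fun w ω => gaussOut σ ξ n d ℓ (T w ω) (ζ ω)) (Z := fun ω => gaussOut σ ξ n d ℓ S (ζ ω))
    (fun w => (hg.comp ((hT w).prodMk hζ.measurable)).aemeasurable)
    (hg.comp (measurable_const.prodMk hζ.measurable)).aemeasurable (by
      filter_upwards [hlim] with ω hω
      have h1 := (continuousOn_gaussOut hσ ξ n (ζ ω) d ℓ) S hS
      exact h1.tendsto.comp (tendsto_nhdsWithin_iff.mpr
        ⟨hω, Eventually.of_forall fun w => hT' w ω⟩))
  have h2 := h.tendsto
  have h3 : (⟨μ.map fun ω => gaussOut σ ξ n d ℓ S (ζ ω),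
      Measure.isProbabilityMeasure_map h.aemeasurable_limit⟩ :
      ProbabilityMeasure (EuclideanSpace ℝ (Fin N))) = gaussOutLaw hσ ξ n d ℓ S := by
    refine Subtype.ext ?_
    change μ.map (fun ω => gaussOut σ ξ n d ℓ S (ζ ω)) =
      (Measure.infinitePi fun _ : ℕ => noiseLaw N).map (gaussOut σ ξ n d ℓ S)
    have h4 : Measurable (gaussOut σ ξ n d ℓ S) := hg.comp measurable_prodMk_left
    rw [← hζ.map_eq, Measure.map_map h4 hζ.measurable]
    rfl
  rw [h3] at h2
  refine h2.congr fun w => Subtype.ext ?_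
  exact (hF w).symm

lemma measurePreserving_noise (N ℓ k : ℕ) :
    MeasurePreserving (fun ζ : ℕ → ℕ → EuclideanSpace ℝ (Fin N) => ζ ℓ k)
      (Measure.infinitePi fun _ : ℕ => noiseLaw N) (stdGaussian (EuclideanSpace ℝ (Fin N))) :=
  MeasurePreserving.comp (g := fun z : ℕ → EuclideanSpace ℝ (Fin N) => z k) (μb := noiseLaw N)
    (measurePreserving_eval_infinitePi (fun _ : ℕ => stdGaussian (EuclideanSpace ℝ (Fin N))) k)
    (measurePreserving_eval_infinitePi (fun _ : ℕ => noiseLaw N) ℓ)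

lemma measurePreserving_covRoot {N : ℕ} (S : Matrix (Fin N) (Fin N) ℝ) :
    MeasurePreserving (covRoot S) (stdGaussian (EuclideanSpace ℝ (Fin N)))
      (multivariateGaussian 0 S) :=
  ⟨(continuous_covRoot S).measurable, map_covRoot_stdGaussian S⟩

lemma ae_tendsto_empCov_noise {N : ℕ} {σ : ℝ → ℝ} {C : NNReal} (hσ : LipschitzWith C σ) (ξ : ℝ)
    (ℓ : ℕ) (S : Matrix (Fin N) (Fin N) ℝ) :
    ∀ᵐ ζ ∂(Measure.infinitePi fun _ : ℕ => noiseLaw N),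
      Tendsto (fun w => empCov ξ w fun k a => σ (covRoot S (ζ ℓ k) a)) atTop
        (𝓝 (Matrix.of fun a c =>
          ∫ h, σ (h a) * σ (h c) ∂(multivariateGaussian 0 S) + ξ ^ 2)) := by
  have hσc := hσ.continuous
  have hg1 : Measurable fun (y : EuclideanSpace ℝ (Fin N)) (a : Fin N) => σ (y a) :=
    Continuous.measurable (by fun_prop)
  have hgm : Measurable fun (z : EuclideanSpace ℝ (Fin N)) (a : Fin N) => σ (covRoot S z a) :=
    hg1.comp (continuous_covRoot S).measurable
  have hmp := (measurePreserving_covRoot S).comp (measurePreserving_noise N ℓ 0)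
  have hlim := ae_tendsto_empCov ξ (μ := Measure.infinitePi fun _ : ℕ => noiseLaw N)
    (w := fun k ζ a => σ (covRoot S (ζ ℓ k) a)) (fun i j hij => ?_) (fun i => ?_) (fun a => ?_)
  · have hint : ∀ a c, ∫ ζ, σ (covRoot S (ζ ℓ 0) a) * σ (covRoot S (ζ ℓ 0) c)
        ∂(Measure.infinitePi fun _ : ℕ => noiseLaw N) =
        ∫ h, σ (h a) * σ (h c) ∂(multivariateGaussian 0 S) := fun a c => by
      rw [← hmp.map_eq, integral_map hmp.measurable.aemeasurable
        (Continuous.aestronglyMeasurable (by fun_prop))]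
      rfl
    simpa only [hint] using hlim
  · have h1 := iIndepFun_uncurry_infinitePi'
      (X := fun (_ _ : ℕ) (z : EuclideanSpace ℝ (Fin N)) (a : Fin N) => σ (covRoot S z a))
      (fun _ _ : ℕ => stdGaussian (EuclideanSpace ℝ (Fin N))) fun _ _ => hgm
    exact h1.indepFun (i := (ℓ, i)) (j := (ℓ, j)) (by simpa using hij)
  · have h1 := measurePreserving_noise N ℓ i
    have h2 := measurePreserving_noise N ℓ 0
    exact IdentDistrib.comp ⟨h1.measurable.aemeasurable, h2.measurable.aemeasurable,
      h1.map_eq.trans h2.map_eq.symm⟩ hgm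
  · exact hσ.memLp_comp ((memLp_eval_multivariateGaussian S a).comp_measurePreserving hmp)

lemma tendsto_gaussOutLaw {N : ℕ} {σ : ℝ → ℝ} {C : NNReal} (hσ : LipschitzWith C σ) (ξ : ℝ)
    (n : ℕ → ℕ) (d ℓ : ℕ) (S : Matrix (Fin N) (Fin N) ℝ) :
    Tendsto (fun w => gaussOutLaw hσ.continuous ξ (Function.update n (ℓ + 1) w) (d + 1) ℓ S) atTop
      (𝓝 (gaussOutLaw hσ.continuous ξ n d (ℓ + 1) (Matrix.of fun a c =>
        ∫ h, σ (h a) * σ (h c) ∂(multivariateGaussian 0 S) + ξ ^ 2))) := by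
  have hσc := hσ.continuous
  have hg1 : Measurable fun (y : EuclideanSpace ℝ (Fin N)) (a : Fin N) => σ (y a) :=
    Continuous.measurable (by fun_prop)
  have hT : ∀ w, Measurable fun ζ : ℕ → ℕ → EuclideanSpace ℝ (Fin N) =>
      empCov ξ w fun k a => σ (covRoot S (ζ ℓ k) a) := fun w =>
    (continuous_empCov ξ w).measurable.comp (measurable_pi_lambda _ fun k =>
      hg1.comp ((continuous_covRoot S).measurable.comp (measurePreserving_noise N ℓ k).measurable))
  refine tendsto_law_gaussOut hσ.continuous ξ n d (ℓ + 1) hT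
    (fun w ζ => posSemidef_empCov ξ w _)
    (posSemidef_integral_mul_add_sq
      (fun a => hσ.memLp_comp (memLp_eval_multivariateGaussian S a)) ξ)
    (MeasurePreserving.id _) (ae_tendsto_empCov_noise hσ ξ ℓ S) fun w => ?_
  refine congrArg (fun f => Measure.map f _) ?_
  ext1 ζ
  rw [gaussOut, Function.update_self]
  exact gaussOut_congr σ ξ d _ _ _ fun i hi => Function.update_of_ne (by omega) _ _

lemma gaussOutLaw_zero {N : ℕ} {σ : ℝ → ℝ} (hσ : Continuous σ) (ξ : ℝ) (n : ℕ → ℕ) (ℓ : ℕ)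
    (S : Matrix (Fin N) (Fin N) ℝ) : gaussOutLaw hσ ξ n 0 ℓ S = centeredGaussian S :=
  Subtype.ext ((measurePreserving_covRoot S).comp (measurePreserving_noise N ℓ 0)).map_eq

/-! ## Second moments of random conjugations -/

lemma continuous_blockUnitary_entry {m : ℕ} (a c : Block m) :
    Continuous fun V : BlockUnitary m => (V : Matrix (Block m) (Block m) ℂ) a c :=
  continuous_subtype_val.matrix_elem a c

lemma integrable_of_continuous_compactSpace {Y : Type*} [TopologicalSpace Y] [CompactSpace Y]
    [MeasurableSpace Y] [OpensMeasurableSpace Y] {μ : Measure Y} [IsFiniteMeasure μ]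
    {f : Y → ℂ} (hf : Continuous f) : Integrable f μ :=
  hf.integrable_of_hasCompactSupport (HasCompactSupport.of_compactSpace f)

/-- The conjugate `Vᴴ M V` of `M` by a unitary `V`. -/
def unitaryConj {m : ℕ} (M : Matrix (Block m) (Block m) ℂ) (V : BlockUnitary m) :
    Matrix (Block m) (Block m) ℂ :=
  (V : Matrix (Block m) (Block m) ℂ)ᴴ * M * (V : Matrix (Block m) (Block m) ℂ)

lemma continuous_unitaryConj {m : ℕ} (M : Matrix (Block m) (Block m) ℂ) (a c : Block m) :
    Continuous fun V : BlockUnitary m => unitaryConj M V a c := by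
  have h : Continuous fun V : BlockUnitary m => (V : Matrix (Block m) (Block m) ℂ) :=
    continuous_subtype_val
  unfold unitaryConj
  exact Continuous.matrix_elem (by fun_prop) a c

lemma conjTranspose_mul_self_blockUnitary {m : ℕ} (V : BlockUnitary m) :
    (V : Matrix (Block m) (Block m) ℂ)ᴴ * (V : Matrix (Block m) (Block m) ℂ) = 1 :=
  Matrix.mem_unitaryGroup_iff'.mp V.2

lemma unitaryConj_apply {m : ℕ} (M : Matrix (Block m) (Block m) ℂ) (V : BlockUnitary m)
    (a c : Block m) : unitaryConj M V a c = ∑ i, ∑ j, M i j * (conj (V i a) * V j c) := by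
  simp only [unitaryConj, Matrix.mul_apply, Matrix.conjTranspose_apply, Finset.sum_mul]
  rw [Finset.sum_comm]
  exact Finset.sum_congr rfl fun i _ => Finset.sum_congr rfl fun j _ => by
    rw [Complex.star_def]; ring

lemma unitaryConj_one {m : ℕ} (V : BlockUnitary m) : unitaryConj 1 V = 1 := by
  rw [unitaryConj, Matrix.mul_one, conjTranspose_mul_self_blockUnitary]

lemma unitaryConj_add {m : ℕ} (M M' : Matrix (Block m) (Block m) ℂ) (V : BlockUnitary m) :
    unitaryConj (M + M') V = unitaryConj M V + unitaryConj M' V := by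
  simp [unitaryConj, Matrix.mul_add, Matrix.add_mul]

lemma unitaryConj_smul {m : ℕ} (z : ℂ) (M : Matrix (Block m) (Block m) ℂ) (V : BlockUnitary m) :
    unitaryConj (z • M) V = z • unitaryConj M V := by
  simp [unitaryConj]

lemma unitaryConj_mul {m : ℕ} (M : Matrix (Block m) (Block m) ℂ) (g V : BlockUnitary m) :
    unitaryConj M (g * V) = unitaryConj (unitaryConj M g) V := by
  simp [unitaryConj, Matrix.conjTranspose_mul, Matrix.mul_assoc]

lemma trace_unitaryConj {m : ℕ} (M : Matrix (Block m) (Block m) ℂ) (V : BlockUnitary m) :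
    (unitaryConj M V).trace = M.trace := by
  have h : (V : Matrix (Block m) (Block m) ℂ) * (V : Matrix (Block m) (Block m) ℂ)ᴴ = 1 :=
    Matrix.mem_unitaryGroup_iff.mp V.2
  rw [unitaryConj, Matrix.trace_mul_cycle, h, Matrix.one_mul]

lemma unitaryConj_mul_unitaryConj {m : ℕ} (M M' : Matrix (Block m) (Block m) ℂ)
    (V : BlockUnitary m) : unitaryConj M V * unitaryConj M' V = unitaryConj (M * M') V := by
  have h : (V : Matrix (Block m) (Block m) ℂ) * (V : Matrix (Block m) (Block m) ℂ)ᴴ = 1 :=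
    Matrix.mem_unitaryGroup_iff.mp V.2
  calc unitaryConj M V * unitaryConj M' V = (V : Matrix (Block m) (Block m) ℂ)ᴴ * M *
        ((V : Matrix (Block m) (Block m) ℂ) * (V : Matrix (Block m) (Block m) ℂ)ᴴ) * M' *
          (V : Matrix (Block m) (Block m) ℂ) := by
        simp only [unitaryConj, Matrix.mul_assoc]
    _ = unitaryConj (M * M') V := by
        rw [h, Matrix.mul_one]; simp only [unitaryConj, Matrix.mul_assoc]

/-- The second moment `E[(Vᴴ M V)_{ac} (Vᴴ M V)_{a'c'}]`. -/
def conjMoment {m : ℕ} (μ : Measure (BlockUnitary m)) (a c a' c' : Block m)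
    (M : Matrix (Block m) (Block m) ℂ) : ℂ :=
  ∫ V, unitaryConj M V a c * unitaryConj M V a' c' ∂μ

lemma integrable_conjMoment {m : ℕ} (μ : Measure (BlockUnitary m)) [IsFiniteMeasure μ]
    (a c a' c' : Block m) (M M' : Matrix (Block m) (Block m) ℂ) :
    Integrable (fun V => unitaryConj M V a c * unitaryConj M' V a' c') μ :=
  integrable_of_continuous_compactSpace
    ((continuous_unitaryConj M a c).mul (continuous_unitaryConj M' a' c'))

instance (m : ℕ) : IsProbabilityMeasure (haarUnitary m) :=
  ⟨by
    have h := Measure.haarMeasure_self (K₀ := (⊤ : TopologicalSpace.PositiveCompacts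
      (BlockUnitary m)))
    change Measure.haarMeasure ⊤ Set.univ = 1
    simpa using h⟩

instance (m : ℕ) : (haarUnitary m).IsMulLeftInvariant := by
  unfold haarUnitary; infer_instance

/-- Only entry moments of degree two in `V` and two in its conjugate occur, exactly those that a
2-design shares with Haar measure. -/
lemma conjMoment_eq_sum {m : ℕ} (μ : Measure (BlockUnitary m)) [IsFiniteMeasure μ]
    (a c a' c' : Block m) (M : Matrix (Block m) (Block m) ℂ) :
    conjMoment μ a c a' c' M = ∑ i, ∑ j, ∑ i', ∑ j', M i j * M i' j' *
      ∫ V : BlockUnitary m, V j c * V j' c' * conj (V i a) * conj (V i' a') ∂μ := by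
  have hint : ∀ i j i' j', Integrable (fun V : BlockUnitary m =>
      M i j * M i' j' * (V j c * V j' c' * conj (V i a) * conj (V i' a'))) μ :=
    fun i j i' j' => integrable_of_continuous_compactSpace (by
      have h1 := continuous_blockUnitary_entry j c
      have h2 := continuous_blockUnitary_entry j' c'
      have h3 := Complex.continuous_conj.comp (continuous_blockUnitary_entry i a)
      have h4 := Complex.continuous_conj.comp (continuous_blockUnitary_entry i' a')
      exact continuous_const.mul (((h1.mul h2).mul h3).mul h4))
  have h : ∀ V : BlockUnitary m, unitaryConj M V a c * unitaryConj M V a' c' =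
      ∑ i, ∑ j, ∑ i', ∑ j', M i j * M i' j' *
        (V j c * V j' c' * conj (V i a) * conj (V i' a')) := fun V => by
    rw [unitaryConj_apply M V a c]
    simp only [Finset.sum_mul]
    refine Finset.sum_congr rfl fun i _ => Finset.sum_congr rfl fun j _ => ?_
    rw [unitaryConj_apply, Finset.mul_sum]
    refine Finset.sum_congr rfl fun i' _ => ?_
    rw [Finset.mul_sum]
    exact Finset.sum_congr rfl fun j' _ => by ring
  simp only [conjMoment, h]
  rw [integral_finsetSum _ fun i _ => integrable_finsetSum _ fun j _ =>
    integrable_finsetSum _ fun i' _ => integrable_finsetSum _ fun j' _ => hint i j i' j']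
  refine Finset.sum_congr rfl fun i _ => ?_
  rw [integral_finsetSum _ fun j _ =>
    integrable_finsetSum _ fun i' _ => integrable_finsetSum _ fun j' _ => hint i j i' j']
  refine Finset.sum_congr rfl fun j _ => ?_
  rw [integral_finsetSum _ fun i' _ => integrable_finsetSum _ fun j' _ => hint i j i' j']
  refine Finset.sum_congr rfl fun i' _ => ?_
  rw [integral_finsetSum _ fun j' _ => hint i j i' j']
  exact Finset.sum_congr rfl fun j' _ => integral_const_mul _ _

lemma IsUnitaryTwoDesign.conjMoment_eq {m : ℕ} {ν : Measure (BlockUnitary m)}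
    (hν : IsUnitaryTwoDesign ν) (a c a' c' : Block m) (M : Matrix (Block m) (Block m) ℂ) :
    conjMoment ν a c a' c' M = conjMoment (haarUnitary m) a c a' c' M := by
  have := hν.isProbabilityMeasure
  simp only [conjMoment_eq_sum, hν.moment_eq]

lemma conjMoment_haar_unitaryConj {m : ℕ} (a c a' c' : Block m)
    (M : Matrix (Block m) (Block m) ℂ) (g : BlockUnitary m) :
    conjMoment (haarUnitary m) a c a' c' (unitaryConj M g) =
      conjMoment (haarUnitary m) a c a' c' M := by
  simp only [conjMoment, ← unitaryConj_mul]
  exact integral_mul_left_eq_self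
    (fun V => unitaryConj M V a c * unitaryConj M V a' c') g

/-! ### Haar second moments from unitary and permutation invariance -/

/-- A permutation of the basis, as a unitary. -/
def permUnitary {m : ℕ} (π : Equiv.Perm (Block m)) : BlockUnitary m :=
  ⟨π.permMatrix ℂ, by
    rw [Matrix.mem_unitaryGroup_iff, Matrix.star_eq_conjTranspose, Matrix.conjTranspose_permMatrix,
      ← Matrix.permMatrix_mul]
    simp⟩

lemma permUnitary_mul_apply {m : ℕ} (π : Equiv.Perm (Block m)) (V : BlockUnitary m)
    (i a : Block m) : (permUnitary π * V : BlockUnitary m) i a = V (π i) a := by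
  have h : π.permMatrix ℂ * (V : Matrix (Block m) (Block m) ℂ) =
      (V : Matrix (Block m) (Block m) ℂ).submatrix π id := PEquiv.toMatrix_toPEquiv_mul π _
  exact congrFun (congrFun h i) a

/-- The fourth moment `E[conj V_{ia} V_{ic} conj V_{ja'} V_{jc'}]` of the Haar measure. -/
def diagMoment {m : ℕ} (a c a' c' i j : Block m) : ℂ :=
  ∫ V : BlockUnitary m, conj (V i a) * V i c * (conj (V j a') * V j c') ∂(haarUnitary m)

lemma diagMoment_perm {m : ℕ} (a c a' c' i j : Block m) (π : Equiv.Perm (Block m)) :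
    diagMoment a c a' c' (π i) (π j) = diagMoment a c a' c' i j := by
  simp only [diagMoment, ← permUnitary_mul_apply]
  exact integral_mul_left_eq_self (μ := haarUnitary m)
    (fun V : BlockUnitary m => conj (V i a) * V i c * (conj (V j a') * V j c')) (permUnitary π)

lemma exists_perm_pair {α : Type*} [DecidableEq α] {i j i' j' : α} (h : i ≠ j) (h' : i' ≠ j') :
    ∃ π : Equiv.Perm α, π i = i' ∧ π j = j' := by
  have h1 : Equiv.swap i i' j ≠ i' := fun e =>
    h ((Equiv.swap i i').injective ((Equiv.swap_apply_left i i').trans e.symm))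
  refine ⟨Equiv.swap (Equiv.swap i i' j) j' * Equiv.swap i i', ?_, ?_⟩
  · rw [Equiv.Perm.mul_apply, Equiv.swap_apply_left, Equiv.swap_apply_of_ne_of_ne h1.symm h']
  · rw [Equiv.Perm.mul_apply, Equiv.swap_apply_left]

/-- Permutations act transitively on equal pairs and on distinct pairs, leaving one value for each
orbit. -/
lemma exists_diagMoment_eq {m : ℕ} (a c a' c' : Block m) :
    ∃ p r : ℂ, ∀ i j, diagMoment a c a' c' i j = if i = j then p else r := by
  obtain ⟨r, hr⟩ : ∃ r : ℂ, ∀ i j : Block m, i ≠ j → diagMoment a c a' c' i j = r := by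
    by_cases h : ∃ i j : Block m, i ≠ j
    · obtain ⟨i, j, hij⟩ := h
      refine ⟨diagMoment a c a' c' i j, fun i' j' hij' => ?_⟩
      obtain ⟨π, rfl, rfl⟩ := exists_perm_pair hij hij'
      exact diagMoment_perm a c a' c' i j π
    · push Not at h
      exact ⟨0, fun i j hij => absurd (h i j) hij⟩
  -- The row label `a` is an arbitrary representative of the diagonal orbit.
  refine ⟨diagMoment a c a' c' a a, r, fun i j => ?_⟩
  split_ifs with h
  · subst h
    simpa using diagMoment_perm a c a' c' a a (Equiv.swap a i)
  · exact hr i j h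

lemma conjMoment_haar_diagonal {m : ℕ} (a c a' c' : Block m) (d : Block m → ℂ) :
    conjMoment (haarUnitary m) a c a' c' (Matrix.diagonal d) =
      ∑ i, ∑ j, d i * d j * diagMoment a c a' c' i j := by
  have hint : ∀ i j, Integrable (fun V : BlockUnitary m =>
      d i * d j * (conj (V i a) * V i c * (conj (V j a') * V j c'))) (haarUnitary m) :=
    fun i j => integrable_of_continuous_compactSpace (by
      have h1 := continuous_blockUnitary_entry i c
      have h2 := continuous_blockUnitary_entry j c'
      have h3 := Complex.continuous_conj.comp (continuous_blockUnitary_entry i a)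
      have h4 := Complex.continuous_conj.comp (continuous_blockUnitary_entry j a')
      exact continuous_const.mul ((h3.mul h1).mul (h4.mul h2)))
  have h : ∀ V : BlockUnitary m, unitaryConj (Matrix.diagonal d) V a c *
      unitaryConj (Matrix.diagonal d) V a' c' =
      ∑ i, ∑ j, d i * d j * (conj (V i a) * V i c * (conj (V j a') * V j c')) := fun V => by
    simp only [unitaryConj_apply, Matrix.diagonal_apply, ite_mul, zero_mul, Finset.sum_ite_eq,
      Finset.mem_univ, if_true]
    rw [Finset.sum_mul_sum]
    exact Finset.sum_congr rfl fun i _ => Finset.sum_congr rfl fun j _ => by ring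
  simp only [conjMoment, h, diagMoment]
  rw [integral_finsetSum _ fun i _ => integrable_finsetSum _ fun j _ => hint i j]
  refine Finset.sum_congr rfl fun i _ => ?_
  rw [integral_finsetSum _ fun j _ => hint i j]
  exact Finset.sum_congr rfl fun j _ => integral_const_mul _ _

/-- After diagonalizing, `∑ d_i d_j D_ij` with `D = p` on the diagonal and `r` off it equals `(p -
r) ∑ d_i² + r (∑ d_i)²`. -/
lemma exists_conjMoment_haar_eq {m : ℕ} (a c a' c' : Block m) :
    ∃ β r : ℂ, ∀ M : Matrix (Block m) (Block m) ℂ, M.IsHermitian →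
      conjMoment (haarUnitary m) a c a' c' M = β * (M * M).trace + r * M.trace ^ 2 := by
  obtain ⟨p, r, hpr⟩ := exists_diagMoment_eq a c a' c'
  refine ⟨p - r, r, fun M hM => ?_⟩
  obtain ⟨g, d, hgd⟩ : ∃ (g : BlockUnitary m) (d : Block m → ℂ),
      unitaryConj M g = Matrix.diagonal d := by
    refine ⟨hM.eigenvectorUnitary, RCLike.ofReal ∘ hM.eigenvalues, ?_⟩
    have h := hM.conjStarAlgAut_star_eigenvectorUnitary
    rw [← h]
    simp [unitaryConj, Unitary.conjStarAlgAut_apply, Matrix.star_eq_conjTranspose]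
  rw [← conjMoment_haar_unitaryConj a c a' c' M g, ← trace_unitaryConj M g,
    ← trace_unitaryConj (M * M) g, ← unitaryConj_mul_unitaryConj, hgd, conjMoment_haar_diagonal,
    Matrix.diagonal_mul_diagonal, Matrix.trace_diagonal, Matrix.trace_diagonal, sq,
    Finset.sum_mul_sum, Finset.mul_sum, Finset.mul_sum, ← Finset.sum_add_distrib]
  refine Finset.sum_congr rfl fun i _ => ?_
  have h : ∀ j, d i * d j * diagMoment a c a' c' i j =
      (if i = j then (p - r) * (d i * d j) else 0) + r * (d i * d j) := fun j => by
    rw [hpr]; split_ifs <;> ring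
  simp only [h, Finset.sum_add_distrib, Finset.sum_ite_eq, Finset.mem_univ, if_true,
    Finset.mul_sum]

lemma conjMoment_one {m : ℕ} (μ : Measure (BlockUnitary m)) [IsProbabilityMeasure μ]
    (a c a' c' : Block m) : conjMoment μ a c a' c' 1 =
      (1 : Matrix (Block m) (Block m) ℂ) a c * (1 : Matrix (Block m) (Block m) ℂ) a' c' := by
  simp [conjMoment, unitaryConj_one]

lemma unitaryConj_single_apply {m : ℕ} (i j a c : Block m) (V : BlockUnitary m) :
    unitaryConj (Matrix.single i j 1) V a c = conj (V i a) * V j c := by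
  rw [unitaryConj_apply, Finset.sum_eq_single i, Finset.sum_eq_single j]
  · simp
  · intro j' _ hj'
    simp [Matrix.single, hj'.symm]
  · simp
  · intro i' _ hi'
    simp [Matrix.single, hi'.symm]
  · simp

/-- For `H = E_ij + E_ji` and `K = I (E_ij - E_ji)` the sum of `H ⊗ H + K ⊗ K` over all `i, j` is
four times the swap operator. Conjugation by `V ⊗ V` fixes the swap, so the integrand is constant.
Both families are Hermitian, as `exists_conjMoment_haar_eq` requires. -/
lemma sum_conjMoment_basis {m : ℕ} (μ : Measure (BlockUnitary m)) [IsProbabilityMeasure μ]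
    (a c a' c' : Block m) :
    ∑ i, ∑ j, (conjMoment μ a c a' c' (Matrix.single i j 1 + Matrix.single j i 1) +
      conjMoment μ a c a' c'
        (Complex.I • (Matrix.single i j 1 + (-1 : ℂ) • Matrix.single j i 1))) =
      4 * ((1 : Matrix (Block m) (Block m) ℂ) a c' * (1 : Matrix (Block m) (Block m) ℂ) a' c) := by
  have h1 : ∀ (i j : Block m) (V : BlockUnitary m),
      unitaryConj (Matrix.single i j 1 + Matrix.single j i 1) V a c *
        unitaryConj (Matrix.single i j 1 + Matrix.single j i 1) V a' c' +
      unitaryConj (Complex.I • (Matrix.single i j 1 + (-1 : ℂ) • Matrix.single j i 1)) V a c *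
        unitaryConj (Complex.I • (Matrix.single i j 1 + (-1 : ℂ) • Matrix.single j i 1)) V a' c' =
      2 * ((conj (V i a) * V i c') * (conj (V j a') * V j c)) +
        2 * ((conj (V j a) * V j c') * (conj (V i a') * V i c)) := fun i j V => by
    simp only [unitaryConj_smul, unitaryConj_add, Matrix.add_apply, Matrix.smul_apply,
      unitaryConj_single_apply, smul_eq_mul]
    linear_combination (((starRingEnd ℂ) (V i a) * V j c - (starRingEnd ℂ) (V j a) * V i c) *
      ((starRingEnd ℂ) (V i a') * V j c' - (starRingEnd ℂ) (V j a') * V i c')) * Complex.I_mul_I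
  have h2 : ∀ (V : BlockUnitary m) (a c : Block m), ∑ i, conj (V i a) * V i c =
      (1 : Matrix (Block m) (Block m) ℂ) a c := fun V a c => by
    rw [← conjTranspose_mul_self_blockUnitary V, Matrix.mul_apply]
    simp
  have h3 : ∀ V : BlockUnitary m, ∑ i, ∑ j,
      (2 * ((conj (V i a) * V i c') * (conj (V j a') * V j c)) +
        2 * ((conj (V j a) * V j c') * (conj (V i a') * V i c))) =
      4 * ((1 : Matrix (Block m) (Block m) ℂ) a c' *
        (1 : Matrix (Block m) (Block m) ℂ) a' c) := fun V => by
    have h4 : ∑ i, ∑ j, (conj (V i a) * V i c') * (conj (V j a') * V j c) =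
        (1 : Matrix (Block m) (Block m) ℂ) a c' * (1 : Matrix (Block m) (Block m) ℂ) a' c := by
      rw [← Finset.sum_mul_sum, h2, h2]
    have h5 : ∑ i, ∑ j, (conj (V j a) * V j c') * (conj (V i a') * V i c) =
        (1 : Matrix (Block m) (Block m) ℂ) a c' * (1 : Matrix (Block m) (Block m) ℂ) a' c := by
      rw [Finset.sum_comm, h4]
    calc _ = 2 * ∑ i, ∑ j, (conj (V i a) * V i c') * (conj (V j a') * V j c) +
          2 * ∑ i, ∑ j, (conj (V j a) * V j c') * (conj (V i a') * V i c) := by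
          simp only [Finset.sum_add_distrib, Finset.mul_sum]
      _ = _ := by rw [h4, h5]; ring
  have hint : ∀ i j, Integrable (fun V : BlockUnitary m =>
      2 * ((conj (V i a) * V i c') * (conj (V j a') * V j c)) +
        2 * ((conj (V j a) * V j c') * (conj (V i a') * V i c))) μ := fun i j => by
    simp only [← h1]
    exact (integrable_conjMoment μ _ _ _ _ _ _).add (integrable_conjMoment μ _ _ _ _ _ _)
  have h4 : ∀ i j, conjMoment μ a c a' c' (Matrix.single i j 1 + Matrix.single j i 1) +
      conjMoment μ a c a' c'
        (Complex.I • (Matrix.single i j 1 + (-1 : ℂ) • Matrix.single j i 1)) =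
      ∫ V : BlockUnitary m, (2 * ((conj (V i a) * V i c') * (conj (V j a') * V j c)) +
        2 * ((conj (V j a) * V j c') * (conj (V i a') * V i c))) ∂μ := fun i j => by
    simp only [← h1]
    exact (integral_add (integrable_conjMoment μ _ _ _ _ _ _)
      (integrable_conjMoment μ _ _ _ _ _ _)).symm
  simp only [h4]
  have h5 : ∑ i, ∑ j, ∫ V : BlockUnitary m,
      (2 * ((conj (V i a) * V i c') * (conj (V j a') * V j c)) +
        2 * ((conj (V j a) * V j c') * (conj (V i a') * V i c))) ∂μ =
      ∫ V : BlockUnitary m, ∑ i, ∑ j,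
      (2 * ((conj (V i a) * V i c') * (conj (V j a') * V j c)) +
        2 * ((conj (V j a) * V j c') * (conj (V i a') * V i c))) ∂μ := by
    rw [integral_finsetSum _ fun i _ => integrable_finsetSum _ fun j _ => hint i j]
    exact Finset.sum_congr rfl fun i _ => (integral_finsetSum _ fun j _ => hint i j).symm
  rw [h5]
  simp only [h3]
  simp

/-- The same test sum evaluated on the trace formula: each pair has `Tr H² + Tr K² = 4`, `(Tr H)² =
4 δ_ij` and `Tr K = 0`. -/
lemma sum_trace_basis {m : ℕ} (β r : ℂ) :
    ∑ i : Block m, ∑ j : Block m,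
      ((β * ((Matrix.single i j (1 : ℂ) + Matrix.single j i 1) *
          (Matrix.single i j 1 + Matrix.single j i 1)).trace +
        r * (Matrix.single i j (1 : ℂ) + Matrix.single j i 1).trace ^ 2) +
      (β * ((Complex.I • (Matrix.single i j (1 : ℂ) + (-1 : ℂ) • Matrix.single j i 1)) *
          (Complex.I • (Matrix.single i j 1 + (-1 : ℂ) • Matrix.single j i 1))).trace +
        r * (Complex.I • (Matrix.single i j (1 : ℂ) +
          (-1 : ℂ) • Matrix.single j i 1)).trace ^ 2)) =
      4 * (β * (Fintype.card (Block m) : ℂ) ^ 2 + r * Fintype.card (Block m)) := by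
  have h1 : ∀ i j : Block m, (Matrix.single i j (1 : ℂ)).trace = if i = j then 1 else 0 :=
    fun i j => by
      split_ifs with h
      · subst h; simp
      · exact Matrix.trace_single_eq_of_ne _ _ _ h
  have h2 : ∀ i j : Block m, (Matrix.single i j (1 : ℂ) * Matrix.single j i 1).trace = 1 :=
    fun i j => by simp
  have h3 : ∀ i j : Block m,
      ((β * ((Matrix.single i j (1 : ℂ) + Matrix.single j i 1) *
          (Matrix.single i j 1 + Matrix.single j i 1)).trace +
        r * (Matrix.single i j (1 : ℂ) + Matrix.single j i 1).trace ^ 2) +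
      (β * ((Complex.I • (Matrix.single i j (1 : ℂ) + (-1 : ℂ) • Matrix.single j i 1)) *
          (Complex.I • (Matrix.single i j 1 + (-1 : ℂ) • Matrix.single j i 1))).trace +
        r * (Complex.I • (Matrix.single i j (1 : ℂ) +
          (-1 : ℂ) • Matrix.single j i 1)).trace ^ 2)) =
      4 * β + 4 * (if i = j then r else 0) := fun i j => by
    have h4 := h2 i j
    have h5 := h2 j i
    simp only [Matrix.add_mul, Matrix.mul_add, Matrix.trace_add, Matrix.trace_smul,
      Matrix.smul_mul, Matrix.mul_smul, smul_add, smul_smul, smul_eq_mul, h4, h5, h1,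
      eq_comm (a := j) (b := i)]
    generalize (Matrix.single i j (1 : ℂ) * Matrix.single i j 1).trace = x
    generalize (Matrix.single j i (1 : ℂ) * Matrix.single j i 1).trace = y
    split_ifs <;> ring_nf <;> simp only [Complex.I_sq] <;> ring
  simp only [h3, Finset.sum_add_distrib, ← Finset.mul_sum, Finset.sum_ite_eq, Finset.mem_univ,
    if_true, Finset.sum_const, Finset.card_univ, nsmul_eq_mul]
  ring

lemma isHermitian_single_add {m : ℕ} (i j : Block m) :
    (Matrix.single i j (1 : ℂ) + Matrix.single j i 1).IsHermitian := by
  rw [Matrix.IsHermitian, Matrix.conjTranspose_add, Matrix.conjTranspose_single,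
    Matrix.conjTranspose_single, star_one, add_comm]

lemma isHermitian_I_smul_single_sub {m : ℕ} (i j : Block m) :
    (Complex.I • (Matrix.single i j (1 : ℂ) + (-1 : ℂ) • Matrix.single j i 1)).IsHermitian := by
  rw [Matrix.IsHermitian, Matrix.conjTranspose_smul, Matrix.conjTranspose_add,
    Matrix.conjTranspose_smul, Matrix.conjTranspose_single,
    Matrix.conjTranspose_single, star_one]
  simp only [Complex.star_def, Complex.conj_I, map_neg, map_one, smul_add, smul_smul]
  rw [add_comm]
  congr 1 <;> simp

/-- The second moments of `Vᴴ M V` under a 2-design, for Hermitian `M`. -/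
lemma IsUnitaryTwoDesign.exists_conjMoment_eq {m : ℕ} (hm : 1 ≤ m)
    {ν : Measure (BlockUnitary m)} (hν : IsUnitaryTwoDesign ν) (a c a' c' : Block m) :
    ∃ r : ℂ, ∀ M : Matrix (Block m) (Block m) ℂ, M.IsHermitian →
      conjMoment ν a c a' c' M =
        ((1 : Matrix (Block m) (Block m) ℂ) a c' * (1 : Matrix (Block m) (Block m) ℂ) a' c -
          (1 : Matrix (Block m) (Block m) ℂ) a c * (1 : Matrix (Block m) (Block m) ℂ) a' c' /
            2 ^ m) / (2 ^ (2 * m) - 1) * (M * M).trace + r * M.trace ^ 2 := by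
  obtain ⟨β, r, h⟩ := exists_conjMoment_haar_eq a c a' c'
  have hcard : (Fintype.card (Block m) : ℂ) = 2 ^ m := by simp
  have h1 := h 1 Matrix.isHermitian_one
  rw [conjMoment_one, Matrix.one_mul, Matrix.trace_one, hcard] at h1
  have h2 := sum_conjMoment_basis (haarUnitary m) a c a' c'
  simp only [h _ (isHermitian_single_add _ _), h _ (isHermitian_I_smul_single_sub _ _)] at h2
  rw [sum_trace_basis, hcard] at h2
  have hd0 : (2 : ℂ) ^ m ≠ 0 := pow_ne_zero _ two_ne_zero
  have hd1 : (2 : ℂ) ^ (2 * m) - 1 ≠ 0 := by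
    have h3 : (1 : ℝ) < 2 ^ (2 * m) := one_lt_pow₀ one_lt_two (by omega)
    have h4 : (2 : ℂ) ^ (2 * m) - 1 = ((2 ^ (2 * m) - 1 : ℝ) : ℂ) := by push_cast; rfl
    rw [h4, Complex.ofReal_ne_zero]
    linarith
  -- With `d = 2 ^ m`, the two tests read `β d + r d² = δ_ac δ_a'c'` and `β d² + r d = δ_ac' δ_a'c`;
  -- eliminating `r` is possible because `d² ≠ 1`.
  have hβ : β = ((1 : Matrix (Block m) (Block m) ℂ) a c' *
      (1 : Matrix (Block m) (Block m) ℂ) a' c - (1 : Matrix (Block m) (Block m) ℂ) a c *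
        (1 : Matrix (Block m) (Block m) ℂ) a' c' / 2 ^ m) / (2 ^ (2 * m) - 1) := by
    rw [eq_div_iff hd1, eq_sub_iff_add_eq, h1]
    have h3 : (2 : ℂ) ^ (2 * m) = (2 ^ m) ^ 2 := by rw [← pow_mul, mul_comm]
    rw [h3]
    field_simp
    linear_combination h2 / 4
  refine ⟨r, fun M hM => ?_⟩
  rw [hν.conjMoment_eq, h M hM, hβ]

lemma IsUnitaryTwoDesign.conjMoment_of_trace_eq_zero {m : ℕ} (hm : 1 ≤ m)
    {ν : Measure (BlockUnitary m)} (hν : IsUnitaryTwoDesign ν)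
    {𝒪 : Matrix (Block m) (Block m) ℂ} (h𝒪 : 𝒪.IsHermitian) (htr : 𝒪.trace = 0)
    (a c a' c' : Block m) :
    ∫ V, unitaryConj 𝒪 V a c * unitaryConj 𝒪 V a' c' ∂ν =
      (𝒪 * 𝒪).trace / (2 ^ (2 * m) - 1) *
        ((1 : Matrix (Block m) (Block m) ℂ) a c' * (1 : Matrix (Block m) (Block m) ℂ) a' c -
          (1 : Matrix (Block m) (Block m) ℂ) a c * (1 : Matrix (Block m) (Block m) ℂ) a' c' /
            2 ^ m) := by
  obtain ⟨r, h⟩ := hν.exists_conjMoment_eq hm a c a' c'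
  have h1 := h 𝒪 h𝒪
  rw [htr] at h1
  rw [conjMoment] at h1
  rw [h1]
  ring

/-- First moments come from second ones by polarization: `Vᴴ 1 V = 1`, so the cross term at `𝒪 + 1`
is linear in `Vᴴ 𝒪 V`. On the trace side this term is a multiple of `Tr 𝒪`, hence 0. -/
lemma IsUnitaryTwoDesign.integral_unitaryConj_eq_zero {m : ℕ} (hm : 1 ≤ m)
    {ν : Measure (BlockUnitary m)} (hν : IsUnitaryTwoDesign ν)
    {𝒪 : Matrix (Block m) (Block m) ℂ} (h𝒪 : 𝒪.IsHermitian) (htr : 𝒪.trace = 0)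
    (a c : Block m) : ∫ V, unitaryConj 𝒪 V a c ∂ν = 0 := by
  have := hν.isProbabilityMeasure
  have hi : ∀ a c, Integrable (fun V => unitaryConj 𝒪 V a c) ν := fun a c =>
    integrable_of_continuous_compactSpace (continuous_unitaryConj 𝒪 a c)
  have key : ∀ a c a' c' : Block m,
      (∫ V, unitaryConj 𝒪 V a c ∂ν) * (1 : Matrix (Block m) (Block m) ℂ) a' c' +
        (1 : Matrix (Block m) (Block m) ℂ) a c * ∫ V, unitaryConj 𝒪 V a' c' ∂ν = 0 := by
    intro a c a' c'
    obtain ⟨r, h⟩ := hν.exists_conjMoment_eq hm a c a' c'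
    have h1 := h 𝒪 h𝒪
    have h2 := h 1 Matrix.isHermitian_one
    have h3 := h (𝒪 + 1) (h𝒪.add Matrix.isHermitian_one)
    have h4 : conjMoment ν a c a' c' (𝒪 + 1) = conjMoment ν a c a' c' 𝒪 +
        ((∫ V, unitaryConj 𝒪 V a c ∂ν) * (1 : Matrix (Block m) (Block m) ℂ) a' c' +
        (1 : Matrix (Block m) (Block m) ℂ) a c * ∫ V, unitaryConj 𝒪 V a' c' ∂ν) +
        conjMoment ν a c a' c' 1 := by
      have h5 : ∀ V, unitaryConj (𝒪 + 1) V a c * unitaryConj (𝒪 + 1) V a' c' =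
          (unitaryConj 𝒪 V a c * unitaryConj 𝒪 V a' c' +
          (unitaryConj 𝒪 V a c * (1 : Matrix (Block m) (Block m) ℂ) a' c' +
            (1 : Matrix (Block m) (Block m) ℂ) a c * unitaryConj 𝒪 V a' c')) +
          (1 : Matrix (Block m) (Block m) ℂ) a c * (1 : Matrix (Block m) (Block m) ℂ) a' c' :=
        fun V => by
          rw [unitaryConj_add, unitaryConj_one, Matrix.add_apply, Matrix.add_apply]
          ring
      have h6 := (hi a c).mul_const ((1 : Matrix (Block m) (Block m) ℂ) a' c')
      have h7 := (hi a' c').const_mul ((1 : Matrix (Block m) (Block m) ℂ) a c)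
      have h8 := integrable_conjMoment ν a c a' c' 𝒪 𝒪
      have h9 : Integrable (fun V => unitaryConj 𝒪 V a c *
          (1 : Matrix (Block m) (Block m) ℂ) a' c' +
            (1 : Matrix (Block m) (Block m) ℂ) a c * unitaryConj 𝒪 V a' c') ν := h6.add h7
      have h10 : Integrable (fun V => unitaryConj 𝒪 V a c * unitaryConj 𝒪 V a' c' +
          (unitaryConj 𝒪 V a c * (1 : Matrix (Block m) (Block m) ℂ) a' c' +
            (1 : Matrix (Block m) (Block m) ℂ) a c * unitaryConj 𝒪 V a' c')) ν := h8.add h9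
      rw [conjMoment_one, conjMoment, conjMoment]
      simp only [h5]
      rw [integral_add h10 (integrable_const _), integral_add h8 h9,
        integral_add h6 h7, integral_mul_const, integral_const_mul]
      simp
    rw [h3, h1, h2] at h4
    simp only [Matrix.add_mul, Matrix.mul_add, Matrix.one_mul, Matrix.mul_one, Matrix.trace_add,
      htr] at h4
    linear_combination -h4
  -- Four equal indices give twice the diagonal entry; this then isolates the general entry.
  have haa : ∫ V, unitaryConj 𝒪 V a a ∂ν = 0 := by
    have h := key a a a a
    rw [Matrix.one_apply_eq] at h
    linear_combination h / 2
  have h := key a c a a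
  rwa [Matrix.one_apply_eq, haa, mul_zero, add_zero, mul_one] at h

/-! ## Tensor products and reduced density matrices -/

lemma tensorMat_mul {nQ m : ℕ} (M M' : Fin nQ → Matrix (Block m) (Block m) ℂ) :
    tensorMat M * tensorMat M' = tensorMat fun k => M k * M' k := by
  ext s t
  simp only [tensorMat, Matrix.mul_apply, Matrix.of_apply, ← Finset.prod_mul_distrib]
  rw [Finset.prod_univ_sum, Fintype.piFinset_univ]

lemma conjTranspose_tensorMat {nQ m : ℕ} (M : Fin nQ → Matrix (Block m) (Block m) ℂ) :
    (tensorMat M)ᴴ = tensorMat fun k => (M k)ᴴ := by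
  ext s t
  simp [tensorMat, Matrix.conjTranspose_apply]

lemma tensorConj_localSum {nQ m : ℕ} (V : Fin nQ → BlockUnitary m)
    (𝒪 : Matrix (Block m) (Block m) ℂ) :
    (tensorMat fun k => (V k : Matrix (Block m) (Block m) ℂ))ᴴ * localSum nQ 𝒪 *
      (tensorMat fun k => (V k : Matrix (Block m) (Block m) ℂ)) =
      ∑ k, tensorMat fun j => if j = k then unitaryConj 𝒪 (V k) else 1 := by
  rw [localSum, Finset.mul_sum, Finset.sum_mul]
  refine Finset.sum_congr rfl fun k _ => ?_
  rw [conjTranspose_tensorMat, tensorMat_mul, tensorMat_mul]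
  congr 1
  ext1 j
  split_ifs with h
  · subst h; rfl
  · rw [Matrix.mul_one]
    exact conjTranspose_mul_self_blockUnitary (V j)

lemma isHermitian_localSum {nQ m : ℕ} {𝒪 : Matrix (Block m) (Block m) ℂ} (h : 𝒪.IsHermitian) :
    (localSum nQ 𝒪).IsHermitian := by
  rw [Matrix.IsHermitian, localSum, Matrix.conjTranspose_sum]
  refine Finset.sum_congr rfl fun k _ => ?_
  rw [conjTranspose_tensorMat]
  congr 1
  ext1 j
  split_ifs
  · exact h
  · exact Matrix.conjTranspose_one

/-- The identity factors kill every `s` that differs from `t` outside block `k`; the survivors are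
the updates of `t` at `k`. -/
lemma sum_mul_tensorMat_single {nQ m : ℕ} (k : Fin nQ) (A : Matrix (Block m) (Block m) ℂ)
    (F : Register nQ m → ℂ) (t : Register nQ m) :
    ∑ s, F s * (tensorMat fun j => if j = k then A else 1) s t =
      ∑ c, F (Function.update t k c) * A c (t k) := by
  symm
  refine Fintype.sum_of_injective (fun c => Function.update t k c)
    (Function.update_injective t k) _ _ (fun s hs => ?_) fun c => ?_
  · have h : ∃ j, j ≠ k ∧ s j ≠ t j := by
      by_contra! hcon
      refine hs ⟨s k, ?_⟩
      ext1 j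
      by_cases hj : j = k
      · subst hj; simp
      · simp [Function.update_of_ne hj, hcon j hj]
    obtain ⟨j, hj, hne⟩ := h
    rw [tensorMat, Matrix.of_apply, Finset.prod_eq_zero (Finset.mem_univ j), mul_zero]
    rw [if_neg hj, Matrix.one_apply_ne hne]
  · congr 1
    rw [tensorMat, Matrix.of_apply, Finset.prod_eq_single k]
    · simp
    · intro j _ hj
      rw [if_neg hj, Function.update_of_ne hj, Matrix.one_apply_eq]
    · simp

lemma trace_mul_reduceTo_pureDensity {nQ m : ℕ} (k : Fin nQ) (A : Matrix (Block m) (Block m) ℂ)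
    (ψ : Register nQ m → ℂ) :
    (A * reduceTo k (pureDensity ψ)).trace =
      ∑ t, ∑ c, star (ψ (Function.update t k c)) * A c (t k) * ψ t := by
  simp only [Matrix.trace, Matrix.diag, Matrix.mul_apply, reduceTo, pureDensity, Matrix.of_apply,
    Matrix.vecMulVec_apply, Finset.mul_sum, mul_ite, mul_zero, Pi.star_apply]
  rw [Finset.sum_comm]
  simp only [Finset.sum_comm (s := (Finset.univ : Finset (Block m)))
    (t := (Finset.univ : Finset (Register nQ m)))]
  refine Finset.sum_congr rfl fun t _ => ?_
  rw [Finset.sum_comm]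
  refine Finset.sum_congr rfl fun c _ => ?_
  rw [Finset.sum_ite_eq]
  simp only [Finset.mem_univ, if_true]
  ring

/-- The defining property of the partial trace: it reproduces expectations of observables acting on
block `k` alone. -/
lemma dotProduct_tensorMat_single {nQ m : ℕ} (k : Fin nQ) (A : Matrix (Block m) (Block m) ℂ)
    (ψ : Register nQ m → ℂ) :
    star ψ ⬝ᵥ (tensorMat (fun j => if j = k then A else 1) *ᵥ ψ) =
      (A * reduceTo k (pureDensity ψ)).trace := by
  rw [trace_mul_reduceTo_pureDensity]
  simp only [dotProduct, mulVec, Finset.mul_sum]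
  rw [Finset.sum_comm]
  refine Finset.sum_congr rfl fun t _ => ?_
  rw [← Finset.sum_mul]
  refine Eq.trans ?_ (congrArg (· * ψ t) (sum_mul_tensorMat_single k A (star ψ) t))
  rw [Finset.sum_mul]
  exact Finset.sum_congr rfl fun s _ => by ring

lemma trace_reducedDensity {X : Type*} {nQ m : ℕ}
    (Uenc : X → Matrix.unitaryGroup (Register nQ m) ℂ) (k : Fin nQ) (x : X) :
    (reducedDensity Uenc k x).trace = 1 := by
  set ψ := encState Uenc x with hψ
  have h1 : (reducedDensity Uenc k x).trace = star ψ ⬝ᵥ ψ := by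
    -- With `A = 1` the trace becomes the squared norm of the encoded state, which unitarity makes
    -- 1.
    have h := dotProduct_tensorMat_single k (1 : Matrix (Block m) (Block m) ℂ) ψ
    have h2 : (tensorMat fun _ : Fin nQ => (1 : Matrix (Block m) (Block m) ℂ)) = 1 := by
      ext s t
      by_cases hst : s = t
      · subst hst; simp [tensorMat]
      · obtain ⟨j, hj⟩ := Function.ne_iff.mp hst
        rw [Matrix.one_apply_ne hst, tensorMat, Matrix.of_apply]
        exact Finset.prod_eq_zero (Finset.mem_univ j) (Matrix.one_apply_ne hj)
    simp only [ite_self, h2, Matrix.one_mulVec, Matrix.one_mul] at h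
    exact h.symm
  have hU : (Uenc x : Matrix (Register nQ m) (Register nQ m) ℂ)ᴴ *
      (Uenc x : Matrix (Register nQ m) (Register nQ m) ℂ) = 1 :=
    Matrix.mem_unitaryGroup_iff'.mp (Uenc x).2
  rw [h1, hψ, encState, Matrix.star_mulVec, ← Matrix.dotProduct_mulVec, Matrix.mulVec_mulVec, hU,
    Matrix.one_mulVec]
  simp [zeroState, dotProduct, Pi.single_apply, apply_ite]

/-- Taking real parts loses nothing since the observable is Hermitian, and `Vᴴ V = 1` removes all
blocks but the `k`-th from the `k`-th term. -/
lemma ofReal_quantumFeature {X : Type*} {nQ m : ℕ}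
    (Uenc : X → Matrix.unitaryGroup (Register nQ m) ℂ) {𝒪 : Matrix (Block m) (Block m) ℂ}
    (h𝒪 : 𝒪.IsHermitian) (V : Fin nQ → BlockUnitary m) (x : X) :
    (quantumFeature Uenc 𝒪 V x : ℂ) =
      ∑ k, (unitaryConj 𝒪 (V k) * reducedDensity Uenc k x).trace := by
  set ψ := encState Uenc x with hψ
  set M := (tensorMat fun k => (V k : Matrix (Block m) (Block m) ℂ))ᴴ * localSum nQ 𝒪 *
    (tensorMat fun k => (V k : Matrix (Block m) (Block m) ℂ)) with hM
  have hMh : M.IsHermitian := Matrix.isHermitian_conjTranspose_mul_mul _ (isHermitian_localSum h𝒪)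
  have h1 : ((quantumFeature Uenc 𝒪 V x : ℝ) : ℂ) = star ψ ⬝ᵥ M *ᵥ ψ := by
    have h2 : conj (star ψ ⬝ᵥ M *ᵥ ψ) = star ψ ⬝ᵥ M *ᵥ ψ := by
      rw [← Complex.star_def, ← Matrix.star_dotProduct_star, star_star, Matrix.star_mulVec,
        hMh.eq, ← Matrix.dotProduct_mulVec]
    exact Complex.conj_eq_iff_re.mp h2
  rw [h1, hM, tensorConj_localSum, Matrix.sum_mulVec, dotProduct_sum]
  exact Finset.sum_congr rfl fun k _ => dotProduct_tensorMat_single k _ ψ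

/-! ## Moments of the quantum features -/

section Moments

variable {m : ℕ} {ν : Measure (BlockUnitary m)} {𝒪 : Matrix (Block m) (Block m) ℂ}

lemma continuous_trace_unitaryConj_mul (𝒪 R : Matrix (Block m) (Block m) ℂ) :
    Continuous fun V : BlockUnitary m => (unitaryConj 𝒪 V * R).trace := by
  simp only [Matrix.trace, Matrix.diag, Matrix.mul_apply]
  exact continuous_finsetSum _ fun a _ => continuous_finsetSum _ fun c _ =>
    (continuous_unitaryConj 𝒪 a c).mul continuous_const

lemma IsUnitaryTwoDesign.integral_trace_eq_zero (hm : 1 ≤ m) (hν : IsUnitaryTwoDesign ν)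
    (h𝒪 : 𝒪.IsHermitian) (htr : 𝒪.trace = 0) (R : Matrix (Block m) (Block m) ℂ) :
    ∫ V, (unitaryConj 𝒪 V * R).trace ∂ν = 0 := by
  have := hν.isProbabilityMeasure
  have hi : ∀ a c, Integrable (fun V => unitaryConj 𝒪 V a c * R c a) ν := fun a c =>
    (integrable_of_continuous_compactSpace (continuous_unitaryConj 𝒪 a c)).mul_const _
  simp only [Matrix.trace, Matrix.diag, Matrix.mul_apply]
  rw [integral_finsetSum _ fun a _ => integrable_finsetSum _ fun c _ => hi a c]
  refine Finset.sum_eq_zero fun a _ => ?_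
  rw [integral_finsetSum _ fun c _ => hi a c]
  refine Finset.sum_eq_zero fun c _ => ?_
  rw [integral_mul_const, hν.integral_unitaryConj_eq_zero hm h𝒪 htr, zero_mul]

/-- Contracting the entry moments with `R` and `R'`: the swap deltas yield `Tr(R R')`, the identity
deltas `Tr R * Tr R'`. -/
lemma IsUnitaryTwoDesign.integral_trace_mul_trace (hm : 1 ≤ m) (hν : IsUnitaryTwoDesign ν)
    (h𝒪 : 𝒪.IsHermitian) (htr : 𝒪.trace = 0) (R R' : Matrix (Block m) (Block m) ℂ) :
    ∫ V, (unitaryConj 𝒪 V * R).trace * (unitaryConj 𝒪 V * R').trace ∂ν =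
      (𝒪 * 𝒪).trace / (2 ^ (2 * m) - 1) * ((R * R').trace - R.trace * R'.trace / 2 ^ m) := by
  have := hν.isProbabilityMeasure
  have hi : ∀ a c a' c', Integrable (fun V =>
      unitaryConj 𝒪 V a c * unitaryConj 𝒪 V a' c' * (R c a * R' c' a')) ν := fun a c a' c' =>
    (integrable_conjMoment ν a c a' c' 𝒪 𝒪).mul_const _
  have h : ∀ V, (unitaryConj 𝒪 V * R).trace * (unitaryConj 𝒪 V * R').trace =
      ∑ a, ∑ c, ∑ a', ∑ c',
        unitaryConj 𝒪 V a c * unitaryConj 𝒪 V a' c' * (R c a * R' c' a') := fun V => by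
    simp only [Matrix.trace, Matrix.diag, Matrix.mul_apply]
    rw [Finset.sum_mul]
    refine Finset.sum_congr rfl fun a _ => ?_
    rw [Finset.sum_mul]
    refine Finset.sum_congr rfl fun c _ => ?_
    rw [Finset.mul_sum]
    refine Finset.sum_congr rfl fun a' _ => ?_
    rw [Finset.mul_sum]
    exact Finset.sum_congr rfl fun c' _ => by ring
  simp only [h]
  have h2 : ∀ a c, ∫ V, ∑ a', ∑ c', unitaryConj 𝒪 V a c * unitaryConj 𝒪 V a' c' *
      (R c a * R' c' a') ∂ν = (𝒪 * 𝒪).trace / (2 ^ (2 * m) - 1) *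
        (R c a * R' a c - (if a = c then R c a else 0) * R'.trace / 2 ^ m) := fun a c => by
    rw [integral_finsetSum _ fun a' _ => integrable_finsetSum _ fun c' _ => hi a c a' c']
    have h3 : ∀ a', ∫ V, ∑ c', unitaryConj 𝒪 V a c * unitaryConj 𝒪 V a' c' *
        (R c a * R' c' a') ∂ν = (𝒪 * 𝒪).trace / (2 ^ (2 * m) - 1) *
          ((if a' = c then R c a * R' a a' else 0) -
            (if a = c then R c a else 0) * R' a' a' / 2 ^ m) := fun a' => by
      rw [integral_finsetSum _ fun c' _ => hi a c a' c']
      simp only [integral_mul_const, hν.conjMoment_of_trace_eq_zero hm h𝒪 htr]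
      simp only [mul_assoc]
      rw [← Finset.mul_sum]
      congr 1
      simp only [sub_mul, Finset.sum_sub_distrib, Matrix.one_apply]
      congr 1
      · split_ifs <;> simp
      · split_ifs
        · simp [ite_div]; ring
        · simp
    simp only [h3, ← Finset.mul_sum, Finset.sum_sub_distrib, Finset.sum_ite_eq', Finset.mem_univ,
      if_true]
    congr 2
    rw [← Finset.sum_div, ← Finset.mul_sum]
    rfl
  have hi1 : ∀ a c, Integrable (fun V => ∑ a', ∑ c',
      unitaryConj 𝒪 V a c * unitaryConj 𝒪 V a' c' * (R c a * R' c' a')) ν := fun a c =>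
    integrable_finsetSum _ fun a' _ => integrable_finsetSum _ fun c' _ => hi a c a' c'
  rw [integral_finsetSum _ fun a _ => integrable_finsetSum _ fun c _ => hi1 a c]
  have h4 : ∀ a, ∫ V, ∑ c, ∑ a', ∑ c', unitaryConj 𝒪 V a c * unitaryConj 𝒪 V a' c' *
      (R c a * R' c' a') ∂ν = (𝒪 * 𝒪).trace / (2 ^ (2 * m) - 1) *
        (∑ c, R c a * R' a c - R a a * R'.trace / 2 ^ m) := fun a => by
    rw [integral_finsetSum _ fun c _ => hi1 a c]
    simp only [h2, ← Finset.mul_sum, Finset.sum_sub_distrib]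
    congr 2
    rw [← Finset.sum_div, ← Finset.sum_mul, Finset.sum_ite_eq]
    simp
  simp only [h4, ← Finset.mul_sum, Finset.sum_sub_distrib]
  congr 2
  · rw [Finset.sum_comm]
    rfl
  · rw [← Finset.sum_div, ← Finset.sum_mul]
    rfl

end Moments

/-! ### The quantum features as an i.i.d. sequence, and the first covariance -/

namespace IsInitialization

variable {X Ω : Type*} [MeasurableSpace Ω] {nQ m : ℕ}
  {ν : Fin nQ → Measure (BlockUnitary m)} {P : Measure Ω}
  {U : ℕ → Fin nQ → Ω → BlockUnitary m} {W : ℕ → ℕ → ℕ → Ω → ℝ} {b : ℕ → ℕ → Ω → ℝ}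

lemma integral_features_mul [IsProbabilityMeasure P] (hI : IsInitialization ν P U W b)
    (hm : 1 ≤ m) (hν : ∀ k, IsUnitaryTwoDesign (ν k))
    (Uenc : X → Matrix.unitaryGroup (Register nQ m) ℂ) {𝒪 : Matrix (Block m) (Block m) ℂ}
    (h𝒪 : 𝒪.IsHermitian) (htr : 𝒪.trace = 0) (ξ : ℝ) (i : ℕ) (x x' : X) :
    ∫ ω, quantumFeature Uenc 𝒪 (fun k => U i k ω) x *
      quantumFeature Uenc 𝒪 (fun k => U i k ω) x' ∂P + ξ ^ 2 = covFirst Uenc 𝒪 ξ x x' := by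
  set T : Fin nQ → X → BlockUnitary m → ℂ :=
    fun k x V => (unitaryConj 𝒪 V * reducedDensity Uenc k x).trace with hT
  have hTc : ∀ k x, Continuous (T k x) := fun k x => continuous_trace_unitaryConj_mul 𝒪 _
  have hTi : ∀ k l, Integrable (fun ω => T k x (U i k ω) * T l x' (U i l ω)) P := by
    intro k l
    have h1 : Continuous fun p : BlockUnitary m × BlockUnitary m => T k x p.1 * T l x' p.2 :=
      ((hTc k x).comp continuous_fst).mul ((hTc l x').comp continuous_snd)
    have h2 : Measurable fun ω => T k x (U i k ω) * T l x' (U i l ω) :=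
      ((hTc k x).measurable.comp (hI.measurable_U i k)).mul
        ((hTc l x').measurable.comp (hI.measurable_U i l))
    obtain ⟨B, hB⟩ := (isCompact_range h1).isBounded.exists_norm_le
    exact Integrable.of_bound h2.aestronglyMeasurable B
      (Eventually.of_forall fun ω => hB _ ⟨(U i k ω, U i l ω), rfl⟩)
  -- Different blocks carry independent unitaries, and each factor has mean zero.
  have hoff : ∀ k l, k ≠ l → ∫ ω, T k x (U i k ω) * T l x' (U i l ω) ∂P = 0 := by
    intro k l hkl
    have hind : IndepFun (U i k) (U i l) P :=
      hI.indep_U.indepFun (i := (i, k)) (j := (i, l)) (by simpa using hkl)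
    have h1 := (hind.comp (hTc k x).measurable (hTc l x').measurable).integral_mul_eq_mul_integral
      ((hTc k x).measurable.comp (hI.measurable_U i k)).aestronglyMeasurable
      ((hTc l x').measurable.comp (hI.measurable_U i l)).aestronglyMeasurable
    have h2 : ∫ ω, (T k x ∘ U i k) ω ∂P = 0 := by
      have h3 := (hI.law_U i k).integral_comp (f := T k x) (hTc k x).aestronglyMeasurable
      rw [h3]
      exact (hν k).integral_trace_eq_zero hm h𝒪 htr _
    rw [h2, zero_mul] at h1
    exact h1
  have hdiag : ∀ k, ∫ ω, T k x (U i k ω) * T k x' (U i k ω) ∂P =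
      (𝒪 * 𝒪).trace / (2 ^ (2 * m) - 1) *
        ((reducedDensity Uenc k x * reducedDensity Uenc k x').trace - 1 / 2 ^ m) := by
    intro k
    have h1 := (hI.law_U i k).integral_comp (f := fun V => T k x V * T k x' V)
      ((hTc k x).mul (hTc k x')).aestronglyMeasurable
    have h2 := (hν k).integral_trace_mul_trace hm h𝒪 htr (reducedDensity Uenc k x)
      (reducedDensity Uenc k x')
    rw [trace_reducedDensity, trace_reducedDensity, one_mul] at h2
    exact h1.trans h2
  have hsum : ((∫ ω, quantumFeature Uenc 𝒪 (fun k => U i k ω) x *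
      quantumFeature Uenc 𝒪 (fun k => U i k ω) x' ∂P : ℝ) : ℂ) =
      (𝒪 * 𝒪).trace / (2 ^ (2 * m) - 1) * ∑ k : Fin nQ,
        ((reducedDensity Uenc k x * reducedDensity Uenc k x').trace - 1 / 2 ^ m) := by
    rw [← integral_complex_ofReal]
    simp only [Complex.ofReal_mul, ofReal_quantumFeature Uenc h𝒪, Finset.sum_mul_sum]
    rw [integral_finsetSum _ fun k _ => integrable_finsetSum _ fun l _ => hTi k l, Finset.mul_sum]
    refine Finset.sum_congr rfl fun k _ => ?_
    rw [integral_finsetSum _ fun l _ => hTi k l, Finset.sum_eq_single k]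
    · exact hdiag k
    · exact fun l _ hl => hoff k l hl.symm
    · simp
  have htr2 : (𝒪 * 𝒪).trace = (((𝒪 * 𝒪).trace.re : ℝ) : ℂ) := by
    refine (Complex.conj_eq_iff_re.mp ?_).symm
    rw [← Complex.star_def, ← Matrix.trace_conjTranspose, Matrix.conjTranspose_mul, h𝒪.eq]
  have hre := congrArg Complex.re hsum
  rw [Complex.ofReal_re] at hre
  rw [hre, covFirst]
  congr 1
  have hc : (𝒪 * 𝒪).trace / (2 ^ (2 * m) - 1) =
      (((𝒪 * 𝒪).trace.re / ((2 : ℝ) ^ (2 * m) - 1) : ℝ) : ℂ) := by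
    rw [htr2]; push_cast; simp
  rw [hc, Complex.re_ofReal_mul, Complex.re_sum]
  congr 1
  refine Finset.sum_congr rfl fun k _ => ?_
  have h1 : (1 / 2 ^ m : ℂ) = ((1 / 2 ^ m : ℝ) : ℂ) := by push_cast; rfl
  rw [Complex.sub_re, h1, Complex.ofReal_re]

lemma memLp_feature [IsProbabilityMeasure P] (hI : IsInitialization ν P U W b)
    (Uenc : X → Matrix.unitaryGroup (Register nQ m) ℂ) (𝒪 : Matrix (Block m) (Block m) ℂ) (i : ℕ)
    (x : X) : MemLp (fun ω => quantumFeature Uenc 𝒪 (fun k => U i k ω) x) 2 P := by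
  have h1 : Continuous fun V : Fin nQ → BlockUnitary m => quantumFeature Uenc 𝒪 V x :=
    (continuous_quantumFeature Uenc 𝒪 x).comp
      (continuous_pi fun k => continuous_subtype_val.comp (continuous_apply k))
  obtain ⟨B, hB⟩ := (isCompact_range h1).isBounded.exists_norm_le
  exact MemLp.of_bound (measurable_quantumFeature Uenc 𝒪 x
    (hI.measurable_U i)).aestronglyMeasurable B (Eventually.of_forall fun ω => hB _ ⟨_, rfl⟩)

lemma measurable_quantumFeature_family (Uenc : X → Matrix.unitaryGroup (Register nQ m) ℂ)
    (𝒪 : Matrix (Block m) (Block m) ℂ) {N : ℕ} (x : Fin N → X) :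
    Measurable fun (V : Fin nQ → BlockUnitary m) (a : Fin N) => quantumFeature Uenc 𝒪 V (x a) :=
  measurable_pi_lambda _ fun a => measurable_quantumFeature Uenc 𝒪 (x a)
    (V := fun k (V : Fin nQ → BlockUnitary m) => V k) fun k => measurable_pi_apply k

lemma indepFun_features (hI : IsInitialization ν P U W b)
    (Uenc : X → Matrix.unitaryGroup (Register nQ m) ℂ) (𝒪 : Matrix (Block m) (Block m) ℂ) {N : ℕ}
    (x : Fin N → X) {i j : ℕ} (hij : i ≠ j) :
    IndepFun (fun ω (a : Fin N) => quantumFeature Uenc 𝒪 (fun k => U i k ω) (x a))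
      (fun ω (a : Fin N) => quantumFeature Uenc 𝒪 (fun k => U j k ω) (x a)) P := by
  have h := hI.indep_U.indepFun_finset ({i} ×ˢ Finset.univ) ({j} ×ˢ Finset.univ)
    (Finset.disjoint_product.mpr (Or.inl (by simpa using hij)))
    fun p => hI.measurable_U p.1 p.2
  have hm : ∀ i : ℕ, Measurable fun (u : ↥(({i} : Finset ℕ) ×ˢ (Finset.univ : Finset (Fin nQ))) →
      BlockUnitary m) (a : Fin N) => quantumFeature Uenc 𝒪
        (fun k => u ⟨(i, k), by simp⟩) (x a) := fun i =>
    (measurable_quantumFeature_family Uenc 𝒪 x).comp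
      (measurable_pi_lambda _ fun k => measurable_pi_apply _)
  exact h.comp (hm i) (hm j)

lemma identDistrib_features [IsProbabilityMeasure P] (hI : IsInitialization ν P U W b)
    (Uenc : X → Matrix.unitaryGroup (Register nQ m) ℂ) (𝒪 : Matrix (Block m) (Block m) ℂ) {N : ℕ}
    (x : Fin N → X) (i j : ℕ) :
    IdentDistrib (fun ω (a : Fin N) => quantumFeature Uenc 𝒪 (fun k => U i k ω) (x a))
      (fun ω (a : Fin N) => quantumFeature Uenc 𝒪 (fun k => U j k ω) (x a)) P P := by
  have hlaw : ∀ i, P.map (fun ω k => U i k ω) = Measure.pi ν := fun i => by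
    have h1 : iIndepFun (fun k => U i k) P :=
      hI.indep_U.precomp (g := fun k : Fin nQ => (i, k)) fun k l h => (Prod.ext_iff.mp h).2
    rw [(iIndepFun_iff_map_fun_eq_pi_map fun k => (hI.measurable_U i k).aemeasurable).mp h1]
    simp only [(hI.law_U i _).map_eq]
  have hm : ∀ i, Measurable fun ω k => U i k ω := fun i =>
    measurable_pi_lambda _ (hI.measurable_U i)
  have h : IdentDistrib (fun ω k => U i k ω) (fun ω k => U j k ω) P P :=
    ⟨(hm i).aemeasurable, (hm j).aemeasurable, by rw [hlaw, hlaw]⟩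
  exact h.comp (measurable_quantumFeature_family Uenc 𝒪 x)

lemma ae_tendsto_empCov_features [IsProbabilityMeasure P] (hI : IsInitialization ν P U W b)
    (hm : 1 ≤ m) (hν : ∀ k, IsUnitaryTwoDesign (ν k))
    (Uenc : X → Matrix.unitaryGroup (Register nQ m) ℂ) {𝒪 : Matrix (Block m) (Block m) ℂ}
    (h𝒪 : 𝒪.IsHermitian) (htr : 𝒪.trace = 0) (ξ : ℝ) {N : ℕ} (x : Fin N → X) :
    ∀ᵐ ω ∂P, Tendsto (fun w => empCov ξ w fun i a =>
      quantumFeature Uenc 𝒪 (fun k => U i k ω) (x a)) atTop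
        (𝓝 (gramMatrix (covFirst Uenc 𝒪 ξ) x)) := by
  have h := ae_tendsto_empCov ξ
    (w := fun i ω (a : Fin N) => quantumFeature Uenc 𝒪 (fun k => U i k ω) (x a))
    (fun i j hij => hI.indepFun_features Uenc 𝒪 x hij)
    (fun i => hI.identDistrib_features Uenc 𝒪 x i 0) fun a => hI.memLp_feature Uenc 𝒪 0 (x a)
  simp only [hI.integral_features_mul hm hν Uenc h𝒪 htr] at h
  exact h

/-- For the first kernel, positivity is read off from its being a second moment of features plus
`ξ²`; the recursion then preserves it. -/
lemma posSemidef_gramMatrix_covQ [IsProbabilityMeasure P] (hI : IsInitialization ν P U W b)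
    (hm : 1 ≤ m) (hν : ∀ k, IsUnitaryTwoDesign (ν k))
    (Uenc : X → Matrix.unitaryGroup (Register nQ m) ℂ) {𝒪 : Matrix (Block m) (Block m) ℂ}
    (h𝒪 : 𝒪.IsHermitian) (htr : 𝒪.trace = 0) {σ : ℝ → ℝ} {C : NNReal} (hσ : LipschitzWith C σ)
    (ξ : ℝ) (ℓ : ℕ) : ∀ (N : ℕ) (x : Fin N → X),
      (gramMatrix (covQ Uenc 𝒪 σ ξ (ℓ + 1)) x).PosSemidef := by
  induction ℓ with
  | zero =>
    intro N x
    have h := posSemidef_integral_mul_add_sq (fun a => hI.memLp_feature Uenc 𝒪 0 (x a)) ξ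
    simp only [hI.integral_features_mul hm hν Uenc h𝒪 htr] at h
    exact h
  | succ ℓ ih =>
    intro N x
    exact posSemidef_gramMatrix_succ ih hσ ξ x

end IsInitialization

/-! ## The sequential limit -/

lemma tendsto_outputLaw {X Ω : Type*} [MeasurableSpace Ω] {P : Measure Ω} [IsProbabilityMeasure P]
    {nQ m : ℕ} {ν : Fin nQ → Measure (BlockUnitary m)} {U : ℕ → Fin nQ → Ω → BlockUnitary m}
    {W : ℕ → ℕ → ℕ → Ω → ℝ} {b : ℕ → ℕ → Ω → ℝ} (hI : IsInitialization ν P U W b)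
    (hm : 1 ≤ m) (hν : ∀ k, IsUnitaryTwoDesign (ν k))
    (Uenc : X → Matrix.unitaryGroup (Register nQ m) ℂ) {𝒪 : Matrix (Block m) (Block m) ℂ}
    (h𝒪 : 𝒪.IsHermitian) (htr : 𝒪.trace = 0) {σ : ℝ → ℝ} {C : NNReal} (hσ : LipschitzWith C σ)
    (ξ : ℝ) (L : ℕ) {N : ℕ} (x : Fin N → X) (n : ℕ → ℕ) :
    Tendsto (fun w => outputLaw hI Uenc 𝒪 hσ.continuous.measurable ξ (L + 1) x
      (Function.update n 0 w)) atTop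
      (𝓝 (gaussOutLaw hσ.continuous ξ n L 0 (gramMatrix (covQ Uenc 𝒪 σ ξ 1) x))) := by
  have hq := hI.measurable_features Uenc 𝒪 x
  have hT : ∀ w, Measurable fun p : Ω × (ℕ → ℕ → EuclideanSpace ℝ (Fin N)) =>
      empCov ξ w fun i a => quantumFeature Uenc 𝒪 (fun k => U i k p.1) (x a) := fun w =>
    (continuous_empCov ξ w).measurable.comp (hq.comp measurable_fst)
  have hfst : MeasurePreserving (Prod.fst : Ω × (ℕ → ℕ → EuclideanSpace ℝ (Fin N)) → Ω)
    (P.prod (Measure.infinitePi fun _ : ℕ => noiseLaw N)) P := measurePreserving_fst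
  refine tendsto_law_gaussOut hσ.continuous ξ n L 0 hT (fun w p => posSemidef_empCov ξ w _)
    (hI.posSemidef_gramMatrix_covQ hm hν Uenc h𝒪 htr hσ ξ 0 N x) measurePreserving_snd
    (hfst.quasiMeasurePreserving.ae
      (hI.ae_tendsto_empCov_features hm hν Uenc h𝒪 htr ξ x)) fun w => ?_
  rw [hI.outputLaw_eq_map_gaussStep Uenc 𝒪 hσ.continuous]
  refine congrArg (fun f => Measure.map f _) ?_
  ext1 p
  have h := chain_gaussStep_eq_gaussOut σ ξ (Function.update n 0 w)
    (fun i a => quantumFeature Uenc 𝒪 (fun k => U i k p.1) (x a)) p.2 L 0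
  rw [zero_add, Function.update_self] at h
  rw [h]
  exact gaussOut_congr σ ξ L _ _ _ fun i hi => Function.update_of_ne (by omega) _ _

end

/-! ### The convergence theorem -/

theorem theorem4 {X Ω : Type*} [MeasurableSpace Ω] (P : Measure Ω) [IsProbabilityMeasure P]
    (nQ m : ℕ) (hm : 1 ≤ m)
    (Uenc : X → Matrix.unitaryGroup (Register nQ m) ℂ)
    (𝒪 : Matrix (Block m) (Block m) ℂ) (h𝒪 : 𝒪.IsHermitian) (htr : 𝒪.trace = 0)
    (ν : Fin nQ → Measure (BlockUnitary m)) (hν : ∀ k, IsUnitaryTwoDesign (ν k))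
    (σ : ℝ → ℝ) (C : NNReal) (hσ : LipschitzWith C σ) (ξ : ℝ)
    (U : ℕ → Fin nQ → Ω → BlockUnitary m) (W : ℕ → ℕ → ℕ → Ω → ℝ) (b : ℕ → ℕ → Ω → ℝ)
    (hI : IsInitialization ν P U W b) (L : ℕ) (hL : 1 < L) :
    -- each `Σ^{(ℓ)}` is a covariance function
    (∀ ℓ, 1 ≤ ℓ → ∀ (N : ℕ) (x : Fin N → X),
      (gramMatrix (covQ Uenc 𝒪 σ ξ ℓ) x).PosSemidef) ∧
    -- the expectations in the recursion are well defined
    (∀ ℓ, 1 ≤ ℓ → ∀ x x' : X,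
      Integrable (fun h : EuclideanSpace ℝ (Fin 2) => σ (h 0) * σ (h 1))
        (gaussianPair (covQ Uenc 𝒪 σ ξ ℓ) x x')) ∧
    -- the finite-dimensional distributions of the output converge to those of the centered
    -- Gaussian process with covariance `Σ^{(L)}`
    (∀ (N : ℕ) (x : Fin N → X),
      SequentialLimit L (outputLaw hI Uenc 𝒪 hσ.continuous.measurable ξ L x)
        (centeredGaussian (gramMatrix (covQ Uenc 𝒪 σ ξ L) x))) := by
  have hpsd := hI.posSemidef_gramMatrix_covQ hm hν Uenc h𝒪 htr hσ ξ
  refine ⟨fun ℓ hℓ N x => ?_, fun ℓ _ x x' => integrable_gaussianPair hσ x x', fun N x => ?_⟩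
  · obtain ⟨ℓ, rfl⟩ := Nat.exists_eq_add_of_le' hℓ
    exact hpsd ℓ N x
  obtain ⟨L, rfl⟩ := Nat.exists_eq_add_of_le' hL.le
  -- The intermediate limits, for depth `L + 1`: once `n 0, …, n ℓ` are infinite, layer `ℓ + 1` is
  -- exactly Gaussian with covariance `Σ^{(ℓ+1)}` and `L - ℓ` random layers follow.
  refine ⟨fun ℓ n => match ℓ with
    | 0 => outputLaw hI Uenc 𝒪 hσ.continuous.measurable ξ (L + 1) x n
    | ℓ + 1 => gaussOutLaw hσ.continuous ξ n (L - ℓ) ℓ (gramMatrix (covQ Uenc 𝒪 σ ξ (ℓ + 1)) x),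
    rfl, fun ℓ hℓ n => ?_, fun n => ?_⟩
  · cases ℓ with
    | zero => exact tendsto_outputLaw hI hm hν Uenc h𝒪 htr hσ ξ L x n
    | succ ℓ =>
      obtain ⟨d, rfl⟩ : ∃ d, L = ℓ + 1 + d := Nat.exists_eq_add_of_le (by omega)
      have h := tendsto_gaussOutLaw hσ ξ n d ℓ (gramMatrix (covQ Uenc 𝒪 σ ξ (ℓ + 1)) x)
      have hg : (Matrix.of fun a c => ∫ h, σ (h a) * σ (h c)
          ∂(multivariateGaussian 0 (gramMatrix (covQ Uenc 𝒪 σ ξ (ℓ + 1)) x)) + ξ ^ 2) =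
          gramMatrix (covQ Uenc 𝒪 σ ξ (ℓ + 1 + 1)) x := by
        ext a c
        exact congrArg (· + ξ ^ 2) (integral_gaussianPair (hpsd ℓ) hσ.continuous x a c).symm
      rw [hg] at h
      simp only [show ℓ + 1 + d - ℓ = d + 1 by omega, show ℓ + 1 + d - (ℓ + 1) = d by omega]
      exact h
  -- No layer is left, so the law is the Gaussian itself.
  · simp only [Nat.sub_self]
    exact gaussOutLaw_zero hσ.continuous ξ n L _
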